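/- **Theorem (Carleman estimate).** Let $d \ge 2$ and let $A = (a_{ij})_{i,j=1}^d : \mathbb{R}^d \to \mathbb{R}^{d\times d}$ have bounded entries of class $C^2$, be symmetric at every point, and be uniformly elliptic: there is $\mu > 0$ with $A(x)\xi\cdot\xi \ge \mu|\xi|^2$ for all $x, \xi \in \mathbb{R}^d$. Let $0 < X < 1$, $0 < \alpha < 1/2$, $R > 0$, and put $$\psi(x) = x_1 + \frac{1}{2X^2}\sum_{i=1}^d x_i^2 + \alpha .$$ Then there are positive numbers $\sigma_0, \sigma_1$, depending only on $d$, $A$, $\alpha$, $X$ and $R$, such that the following holds for every open set $\Omega \subset \mathbb{R}^d$ with smooth boundary, contained in the ball $\{|x| < R\}$, such that $$\Omega \subset \Big\{ x : 0 < x_1 + X^{-2}\sum_{i=2}^d x_i^2 < 1 \Big\} \quad\text{and}\quad \psi > 0 \text{ on } \overline\Omega$$ (the last condition holds automatically if $\alpha > X^2/8$). 1. There is a constant $C > 0$ such that for all $\lambda > \sigma_0$, all $p > \sigma_1$ and all $u \in C^2(\overline\Omega)$ with $u = A\nabla u\cdot\nu = 0$ on $\partial\Omega$, where $\nu$ is the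 outward unit normal vector of $\partial\Omega$, $$\frac{\lambda p}{X^2}\int_\Omega e^{2\lambda\psi^{-p}}|\nabla u|^2\,dx + \lambda^3p^4\int_\Omega \psi^{-2p-2}e^{2\lambda\psi^{-p}}|u|^2\,dx \le C\int_\Omega \psi^{p+2}e^{2\lambda\psi^{-p}}|\mathrm{Div}(A\nabla u)|^2\,dx .$$ 2. For every $p > \sigma_1$ there is a constant $C > 0$ such that for all $\lambda > \sigma_0$ and all $u$ as in 1, $$\lambda p\int_\Omega e^{2\lambda\psi^{-p}}|\nabla u|^2\,dx + \lambda^3p^4\int_\Omega e^{2\lambda\psi^{-p}}|u|^2\,dx \le C\int_\Omega e^{2\lambda\psi^{-p}}|\mathrm{Div}(A\nabla u)|^2\,dx .$$ -/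

import Mathlib

open MeasureTheory Topology
open scoped Matrix ContDiff

noncomputable section

namespace Carleman

/-- The Euclidean space `ℝ^d`. The coordinate called `x₁` in the mathematics is `x 0`. -/
abbrev E (d : ℕ) : Type := EuclideanSpace ℝ (Fin d)

/-- The product of a matrix and a vector of `ℝ^d`. -/
def mulVecE {d : ℕ} (M : Matrix (Fin d) (Fin d) ℝ) (v : E d) : E d :=
  WithLp.toLp 2 (M *ᵥ v.ofLp)

/-- The matrix field `A = (a_ij)` has bounded entries of class `C²` on `ℝ^d`, is symmetric at every
point, and is uniformly elliptic. -/
structure IsEllipticCoefficient {d : ℕ} (A : E d → Matrix (Fin d) (Fin d) ℝ) : Prop where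
  contDiff : ∀ i j, ContDiff ℝ 2 (fun x => A x i j)
  bounded : ∃ K : ℝ, ∀ x i j, |A x i j| ≤ K
  symm : ∀ x, (A x)ᵀ = A x
  elliptic : ∃ μ : ℝ, 0 < μ ∧ ∀ x ξ : E d, μ * ‖ξ‖ ^ 2 ≤ inner ℝ (mulVecE (A x) ξ) ξ

/-- Near the boundary point `x`, the set `Ω` is `{ρ < 0}`, where `ρ` is smooth near `x` and its
gradient at `x` does not vanish. -/
def IsDefiningFunctionAt {d : ℕ} (Ω : Set (E d)) (x : E d) (ρ : E d → ℝ) : Prop :=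
  gradient ρ x ≠ 0 ∧
    ∃ U : Set (E d), IsOpen U ∧ x ∈ U ∧ ContDiffOn ℝ ∞ ρ U ∧ ∀ y ∈ U, y ∈ Ω ↔ ρ y < 0

/-- The boundary of `Ω` is smooth (and `Ω` lies locally on one side of it). -/
def HasSmoothBoundary {d : ℕ} (Ω : Set (E d)) : Prop :=
  ∀ x ∈ frontier Ω, ∃ ρ : E d → ℝ, IsDefiningFunctionAt Ω x ρ

/-- `ν` is the outward unit normal vector of `∂Ω` at `x`. -/
def IsOutwardUnitNormal {d : ℕ} (Ω : Set (E d)) (x ν : E d) : Prop :=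
  ∃ ρ : E d → ℝ, IsDefiningFunctionAt Ω x ρ ∧ ν = ‖gradient ρ x‖⁻¹ • gradient ρ x

/-- The divergence of a vector field on `ℝ^d`. -/
def divergence {d : ℕ} (F : E d → E d) (x : E d) : ℝ :=
  ∑ i, fderiv ℝ (fun y => F y i) x (EuclideanSpace.single i 1)

/-- The operator `Div (A ∇u)`, at interior points. -/
def divAGrad {d : ℕ} (A : E d → Matrix (Fin d) (Fin d) ℝ) (u : E d → ℝ) (x : E d) : ℝ :=
  divergence (fun y => mulVecE (A y) (gradient u y)) x

/-- `u ∈ C²(closure Ω)` with `u = A ∇u · ν = 0` on `∂Ω`. On `∂Ω` the gradient is the one of `u` as a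
function on the closure of `Ω`. -/
structure IsC2WithZeroCauchyData {d : ℕ} (A : E d → Matrix (Fin d) (Fin d) ℝ) (Ω : Set (E d))
    (u : E d → ℝ) : Prop where
  contDiffOn : ContDiffOn ℝ 2 u (closure Ω)
  dirichlet : ∀ x ∈ frontier Ω, u x = 0
  conormal : ∀ x ∈ frontier Ω, ∀ ν : E d, IsOutwardUnitNormal Ω x ν →
    inner ℝ (mulVecE (A x) (gradientWithin u (closure Ω) x)) ν = 0

/-- The region `{0 < x₁ + X⁻² (x₂² + ⋯ + x_d²) < 1}`. -/
def paraboloidStrip (d : ℕ) [NeZero d] (X : ℝ) : Set (E d) :=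
  {x | 0 < x 0 + (X ^ 2)⁻¹ * ∑ i ∈ Finset.univ.erase 0, (x i) ^ 2 ∧
    x 0 + (X ^ 2)⁻¹ * ∑ i ∈ Finset.univ.erase 0, (x i) ^ 2 < 1}

/-- `ψ(x) = x₁ + (x₁² + ⋯ + x_d²) / (2 X²) + α`. -/
def psi {d : ℕ} [NeZero d] (X α : ℝ) (x : E d) : ℝ :=
  x 0 + 1 / (2 * X ^ 2) * ∑ i, (x i) ^ 2 + α

/-- The Carleman weight `exp (2 λ ψ(x)^(-p))`. -/
def weight {d : ℕ} [NeZero d] (X α l p : ℝ) (x : E d) : ℝ :=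
  Real.exp (2 * l * (psi X α x) ^ (-p))

end Carleman

end

/-!
The estimate is the integral over `Ω` of a pointwise inequality: after multiplication by `λ`, the
left integrand is bounded by a constant times the right one plus the divergence of a `C¹` vector
field that is quadratic in `(u, ∇u)`.

*No boundary terms.* Since `u = 0` on `∂Ω`, the tangential derivatives of `u` vanish there, and the
conormal condition with ellipticity makes the normal one vanish too
(`IsC2WithZeroCauchyData.gradientWithin_eq_zero`). A quadratic expression in `(u, ∇u)` therefore
vanishes to second order at `∂Ω`, so its extension by zero is differentiable on the whole space, and
the integral of its divergence over `Ω` is zero (`integral_divergence_eq_zero`).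

*The multiplier.* Write `z = λ ψ^(-p)`, `Q = A ∇ψ · ∇ψ`, `B = A ∇ψ / Q`. On the region considered,
`∇ψ` is bounded away from zero (`le_norm_gradPsi`), so `B` is of class `C¹`. The expression
`Div (A ∇u)` is multiplied by `-2 p ψ e^{2z} B · ∇u + c u` with
`c = 2 p² z e^{2z} + p² χ(z)` (`divergence_carlemanField`). With `r = ψ p⁻¹ B · ∇u - z u`, the leading
terms are
`p⁴ ψ⁻² Q (4 z e^{2z} r² + ((2 z² - z) e^{2z} - (z d/dz)² χ / 2) u²) + p² χ A ∇u · ∇u`.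
Without `χ` this is the classical computation, which gives a positive coefficient of `u²` only for
`z > 1/2`. As `ψ` may exceed `1`, `z` becomes arbitrarily small as `p` grows, whatever the
lower bound on `λ`. The energy term with `χ(z) = 100 - 10 z + e^{2z} / 4` repairs this: its part `-10 z`
makes the coefficient of `u²` positive for all `z > 0` (`le_zeroOrder`), and `χ ≥ e^{2z} / 8`
controls the gradient with the factor `p²`. All remaining terms, which come from the derivatives of
`A`, `B` and `∇ψ`, are smaller by a factor `p⁻¹`, so they are absorbed for large `p`
(`pointwise_le`).

The second part follows from the first, because `ψ` is bounded above.
-/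

namespace Carleman

open Set Filter Asymptotics

/-! ### Integrating a divergence over a domain -/

/-- A function that vanishes to second order at a boundary point of `Ω`, when approached from
within `Ω`, has an extension by zero with derivative zero there. -/
lemma hasFDerivAt_indicator_zero {V : Type*} [NormedAddCommGroup V] [NormedSpace ℝ V]
    {s : Set V} {f : V → ℝ} {x : V}
    (hf : f =O[𝓝[s] x] fun y => ‖y - x‖ ^ 2) :
    HasFDerivAt (s.indicator f) (0 : V →L[ℝ] ℝ) x := by
  have h : s.indicator f =O[𝓝 x] fun y => ‖y - x‖ ^ 2 := by
    obtain ⟨C, hC0, hC⟩ := hf.exists_nonneg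
    have hC' := eventually_nhdsWithin_iff.1 hC.bound
    refine IsBigO.of_bound C ?_
    filter_upwards [hC'] with y hy
    by_cases hys : y ∈ s
    · simpa [indicator_of_mem hys] using hy hys
    · simp only [indicator_of_notMem hys, norm_zero]
      positivity
  exact h.hasFDerivAt (by norm_num)

/-- The integral over `Ω` of a directional derivative vanishes when the function vanishes to
second order at the boundary. -/
lemma integral_fderiv_eq_zero {d : ℕ} {Ω : Set (E d)} (hΩ : IsOpen Ω)
    (hb : Bornology.IsBounded Ω) {f : E d → ℝ} (hf : ∀ x ∈ Ω, DifferentiableAt ℝ f x)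
    (hfront : ∀ x ∈ frontier Ω, f =O[𝓝[Ω] x] fun y => ‖y - x‖ ^ 2)
    (v : E d) (hint : IntegrableOn (fun x => fderiv ℝ f x v) Ω) :
    ∫ x in Ω, fderiv ℝ f x v = 0 := by
  have hder : ∀ x, HasFDerivAt (Ω.indicator f) (Ω.indicator (fderiv ℝ f) x) x := by
    intro x
    by_cases hx : x ∈ Ω
    · rw [indicator_of_mem hx]
      refine (hf x hx).hasFDerivAt.congr_of_eventuallyEq ?_
      filter_upwards [hΩ.mem_nhds hx] with y hy using indicator_of_mem hy f
    · rw [indicator_of_notMem hx]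
      by_cases hxc : x ∈ closure Ω
      · exact hasFDerivAt_indicator_zero (hfront x (by
          rw [frontier, hΩ.interior_eq]; exact ⟨hxc, hx⟩))
      · refine (hasFDerivAt_const (0 : ℝ) x).congr_of_eventuallyEq ?_
        filter_upwards [isClosed_closure.isOpen_compl.mem_nhds hxc] with y hy
        exact indicator_of_notMem (fun h => hy (subset_closure h)) f
  have hcont : Continuous (Ω.indicator f) :=
    continuous_iff_continuousAt.2 fun x => (hder x).continuousAt
  have hcs : HasCompactSupport (Ω.indicator f) := by
    refine HasCompactSupport.of_support_subset_isCompact hb.isCompact_closure ?_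
    exact (support_indicator_subset).trans subset_closure
  have key := integral_bilinear_hasLineDerivAt_right_eq_neg_left_of_integrable
    (μ := (volume : Measure (E d)))
    (f := Ω.indicator f) (f' := fun x => Ω.indicator (fderiv ℝ f) x v)
    (g := fun _ => (1 : ℝ)) (g' := fun _ => (0 : ℝ)) (v := v)
    (B := ContinuousLinearMap.mul ℝ ℝ)
  have hind : (fun x => Ω.indicator (fderiv ℝ f) x v)
      = Ω.indicator (fun x => fderiv ℝ f x v) := by
    ext x
    by_cases hx : x ∈ Ω <;> simp [hx]
  have hi : Integrable (fun x => Ω.indicator (fderiv ℝ f) x v) := by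
    rw [hind]; exact hint.integrable_indicator hΩ.measurableSet
  have := key (by simpa using hi) (by simp)
    (by simpa using hcont.integrable_of_hasCompactSupport hcs)
    (fun x _ => (hder x).hasLineDerivAt v)
    (fun x _ => (hasFDerivAt_const (1 : ℝ) x).hasLineDerivAt v)
  simp only [ContinuousLinearMap.mul_apply', mul_zero, mul_one, integral_zero] at this
  rw [hind, integral_indicator hΩ.measurableSet] at this
  linarith

/-- The divergence along `closure Ω`, which extends the divergence continuously to `closure Ω`
when the field is of class `C¹` there. -/
noncomputable def divergenceWithin {d : ℕ} (s : Set (E d)) (F : E d → E d) (x : E d) : ℝ :=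
  ∑ i, (fderivWithin ℝ F s x (EuclideanSpace.single i 1)) i

lemma _root_.HasFDerivAt.divergence_eq {d : ℕ} {F : E d → E d} {F' : E d →L[ℝ] E d} {x : E d}
    (h : HasFDerivAt F F' x) :
    divergence F x = ∑ i, (F' (EuclideanSpace.single i 1)) i := by
  refine Finset.sum_congr rfl fun i _ => ?_
  have := (((EuclideanSpace.proj i : E d →L[ℝ] ℝ).hasFDerivAt (x := F x)).comp x h)
  have h2 : HasFDerivAt (fun y => F y i) ((EuclideanSpace.proj i : E d →L[ℝ] ℝ).comp F') x := this
  rw [h2.fderiv]; rfl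

lemma divergenceWithin_eq {d : ℕ} {Ω : Set (E d)} (hΩ : IsOpen Ω) {F : E d → E d}
    (hF : ContDiffOn ℝ 1 F (closure Ω)) {x : E d} (hx : x ∈ Ω) :
    divergenceWithin (closure Ω) F x = divergence F x := by
  have hn : closure Ω ∈ 𝓝 x := mem_of_superset (hΩ.mem_nhds hx) subset_closure
  have hd : DifferentiableAt ℝ F x :=
    ((hF x (subset_closure hx)).contDiffAt hn).differentiableAt (by norm_num)
  rw [hd.hasFDerivAt.divergence_eq, divergenceWithin, fderivWithin_of_mem_nhds hn]

lemma continuousOn_divergenceWithin {d : ℕ} {s : Set (E d)} (hs : UniqueDiffOn ℝ s)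
    {F : E d → E d} (hF : ContDiffOn ℝ 1 F s) :
    ContinuousOn (divergenceWithin s F) s := by
  refine continuousOn_finsetSum _ fun i _ => ?_
  have h1 := hF.continuousOn_fderivWithin hs le_rfl
  have h2 : ContinuousOn (fun x => fderivWithin ℝ F s x (EuclideanSpace.single i 1)) s :=
    h1.clm_apply continuousOn_const
  exact (EuclideanSpace.proj i : E d →L[ℝ] ℝ).continuous.comp_continuousOn h2

lemma continuousOn_divergence {d : ℕ} {s : Set (E d)} (hs : IsOpen s) {F : E d → E d}
    (hF : ContDiffOn ℝ 1 F s) : ContinuousOn (divergence F) s := by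
  refine (continuousOn_divergenceWithin hs.uniqueDiffOn hF).congr fun x hx => ?_
  rw [((hF.differentiableOn (by norm_num) x hx).differentiableAt
    (hs.mem_nhds hx)).hasFDerivAt.divergence_eq, divergenceWithin,
    fderivWithin_of_mem_nhds (hs.mem_nhds hx)]

lemma _root_.ContinuousOn.integrableOn_of_isBounded {d : ℕ} {Ω : Set (E d)}
    (hb : Bornology.IsBounded Ω) {f : E d → ℝ} (hf : ContinuousOn f (closure Ω)) :
    IntegrableOn f Ω :=
  (hf.integrableOn_compact hb.isCompact_closure).mono_set subset_closure

lemma integrableOn_divergence {d : ℕ} {Ω : Set (E d)} (hΩ : IsOpen Ω)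
    (hb : Bornology.IsBounded Ω) (hu : UniqueDiffOn ℝ (closure Ω)) {F : E d → E d}
    (hF : ContDiffOn ℝ 1 F (closure Ω)) : IntegrableOn (divergence F) Ω :=
  (ContinuousOn.integrableOn_of_isBounded hb (continuousOn_divergenceWithin hu hF)).congr_fun
    (fun _ hx => divergenceWithin_eq hΩ hF hx) hΩ.measurableSet

/-- The divergence theorem for a field that vanishes to second order at the boundary; no boundary
term appears, and no surface measure is needed. -/
theorem integral_divergence_eq_zero {d : ℕ} {Ω : Set (E d)} (hΩ : IsOpen Ω)
    (hb : Bornology.IsBounded Ω) (hu : UniqueDiffOn ℝ (closure Ω)) {F : E d → E d}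
    (hF : ContDiffOn ℝ 1 F (closure Ω))
    (hfront : ∀ x ∈ frontier Ω, F =O[𝓝[Ω] x] fun y => ‖y - x‖ ^ 2) :
    ∫ x in Ω, divergence F x = 0 := by
  have hcomp : ∀ i, ContDiffOn ℝ 1 (fun y => F y i) (closure Ω) := fun i =>
    (EuclideanSpace.proj i : E d →L[ℝ] ℝ).contDiff.comp_contDiffOn hF
  have hint : ∀ i, IntegrableOn
      (fun x => fderiv ℝ (fun y => F y i) x (EuclideanSpace.single i 1)) Ω := by
    intro i
    have h1 := (hcomp i).continuousOn_fderivWithin hu le_rfl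
    have h2 : ContinuousOn (fun x => fderivWithin ℝ (fun y => F y i) (closure Ω) x
        (EuclideanSpace.single i 1)) (closure Ω) := h1.clm_apply continuousOn_const
    refine (ContinuousOn.integrableOn_of_isBounded hb h2).congr_fun (fun x hx => ?_)
      hΩ.measurableSet
    simp only [fderivWithin_of_mem_nhds (mem_of_superset (hΩ.mem_nhds hx) subset_closure)]
  simp only [divergence]
  rw [integral_finsetSum _ fun i _ => hint i]
  refine Finset.sum_eq_zero fun i _ => integral_fderiv_eq_zero hΩ hb (fun x hx => ?_)
    (fun x hx => ?_) _ (hint i)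
  · exact ((hcomp i x (subset_closure hx)).contDiffAt
      (mem_of_superset (hΩ.mem_nhds hx) subset_closure)).differentiableAt (by norm_num)
  · refine (IsBigO.of_bound 1 (Eventually.of_forall fun y => ?_)).trans (hfront x hx)
    simpa using PiLp.norm_apply_le (F y) i

/-! ### The boundary of a smooth domain -/

/-- A connected set that meets `s` and its complement meets the frontier of `s`. -/
lemma _root_.IsPreconnected.exists_mem_frontier {X : Type*} [TopologicalSpace X] {s t : Set X}
    (ht : IsPreconnected t) (h1 : (t ∩ s).Nonempty) (h2 : (t ∩ sᶜ).Nonempty) :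
    (t ∩ frontier s).Nonempty := by
  by_contra hne
  have hfr : ∀ y ∈ t, y ∉ frontier s := fun y hy hyf => hne ⟨y, hy, hyf⟩
  obtain ⟨y, hy, hys⟩ := h1
  obtain ⟨z, hz, hzs⟩ := h2
  obtain ⟨w, -, hw1, hw2⟩ := ht (interior s) (closure s)ᶜ isOpen_interior
    isClosed_closure.isOpen_compl
    (fun w hw => by
      by_contra hwn
      simp only [mem_union, mem_compl_iff, not_or, not_not] at hwn
      exact hfr w hw ⟨hwn.2, hwn.1⟩)
    ⟨y, hy, by_contra fun h => hfr y hy ⟨subset_closure hys, h⟩⟩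
    ⟨z, hz, fun h => hfr z hz ⟨h, fun h' => hzs (interior_subset h')⟩⟩
  exact hw2 (subset_closure (interior_subset hw1))

section Boundary

variable {d : ℕ} {Ω : Set (E d)} {x : E d} {ρ : E d → ℝ}

/-- `x + t v`, as a curve in `t`, is a tangent curve along which the defining function has
derivative `⟪∇ρ, v⟫`. -/
lemma IsDefiningFunctionAt.hasDerivAt_line (h : IsDefiningFunctionAt Ω x ρ) (v : E d) :
    HasDerivAt (fun t : ℝ => ρ (x + t • v)) (inner ℝ (gradient ρ x) v) 0 := by
  obtain ⟨_, U, hU, hxU, hρ, _⟩ := h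
  have hd : DifferentiableAt ℝ ρ x :=
    ((hρ x hxU).contDiffAt (hU.mem_nhds hxU)).differentiableAt (by simp)
  have hg := hd.hasGradientAt.hasFDerivAt
  have hline : HasDerivAt (fun t : ℝ => x + t • v) v 0 := by
    simpa using ((hasDerivAt_id (0 : ℝ)).smul_const v).const_add x
  have := hg.comp_hasDerivAt_of_eq (0 : ℝ) hline (by simp)
  simpa [Function.comp_def] using this

lemma IsDefiningFunctionAt.eventually_mem_iff (h : IsDefiningFunctionAt Ω x ρ) (v : E d) :
    ∀ᶠ t in 𝓝[>] (0 : ℝ), x + t • v ∈ Ω ↔ ρ (x + t • v) < 0 := by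
  obtain ⟨_, U, hU, hxU, _, hiff⟩ := h
  have hc : Tendsto (fun t : ℝ => x + t • v) (𝓝[>] 0) (𝓝 x) := by
    have : Continuous (fun t : ℝ => x + t • v) := by fun_prop
    have h0 := this.tendsto 0
    simp only [zero_smul, add_zero] at h0
    exact h0.mono_left nhdsWithin_le_nhds
  filter_upwards [hc.eventually (hU.mem_nhds hxU)] with t ht using hiff _ ht

lemma IsDefiningFunctionAt.eq_zero (h : IsDefiningFunctionAt Ω x ρ) (hx : x ∈ frontier Ω) :
    ρ x = 0 := by
  obtain ⟨_, U, hU, hxU, hρ, hiff⟩ := h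
  have hc : ContinuousAt ρ x := (hρ x hxU).continuousWithinAt.continuousAt (hU.mem_nhds hxU)
  have hUx := hU.mem_nhds hxU
  rcases lt_trichotomy (ρ x) 0 with hlt | h0 | hgt
  · have : Ω ∈ 𝓝 x := by
      filter_upwards [hc.eventually (gt_mem_nhds hlt), hUx] with y hy hyU using (hiff y hyU).2 hy
    exact absurd (mem_interior_iff_mem_nhds.2 this) hx.2
  · exact h0
  · have : Ωᶜ ∈ 𝓝 x := by
      filter_upwards [hc.eventually (lt_mem_nhds hgt), hUx] with y hy hyU hyΩ
      exact lt_asymm hy ((hiff y hyU).1 hyΩ)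
    rw [← mem_interior_iff_mem_nhds, interior_compl] at this
    exact absurd hx.1 this

lemma IsDefiningFunctionAt.eventually_mem (h : IsDefiningFunctionAt Ω x ρ) (hx : x ∈ frontier Ω)
    {v : E d} (hv : inner ℝ (gradient ρ x) v < 0) : ∀ᶠ t in 𝓝[>] (0 : ℝ), x + t • v ∈ Ω := by
  have h1 := (hasDerivAt_iff_tendsto_slope.1 (h.hasDerivAt_line v)).eventually (gt_mem_nhds hv)
  have h2 := h1.filter_mono (nhdsGT_le_nhdsNE 0)
  filter_upwards [h2, h.eventually_mem_iff v, self_mem_nhdsWithin] with t ht hiff ht0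
  rw [hiff]
  have ht0 : 0 < t := ht0
  simp only [slope_def_field, zero_smul, add_zero, h.eq_zero hx, sub_zero] at ht
  exact (div_neg_iff.1 ht).resolve_left (fun h => absurd h.2 ht0.not_gt) |>.1

lemma IsDefiningFunctionAt.eventually_notMem (h : IsDefiningFunctionAt Ω x ρ)
    (hx : x ∈ frontier Ω) {v : E d} (hv : 0 < inner ℝ (gradient ρ x) v) :
    ∀ᶠ t in 𝓝[>] (0 : ℝ), x + t • v ∉ Ω := by
  have h1 := (hasDerivAt_iff_tendsto_slope.1 (h.hasDerivAt_line v)).eventually (lt_mem_nhds hv)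
  have h2 := h1.filter_mono (nhdsGT_le_nhdsNE 0)
  filter_upwards [h2, h.eventually_mem_iff v, self_mem_nhdsWithin] with t ht hiff ht0
  rw [hiff]
  have ht0 : 0 < t := ht0
  simp only [slope_def_field, zero_smul, add_zero, h.eq_zero hx, sub_zero] at ht
  rw [not_lt]
  exact ((div_pos_iff_of_pos_right ht0).1 ht).le

/-- The directions pointing into `Ω` form an open half space, which spans. -/
lemma IsDefiningFunctionAt.uniqueDiffWithinAt (h : IsDefiningFunctionAt Ω x ρ)
    (hx : x ∈ frontier Ω) : UniqueDiffWithinAt ℝ (closure Ω) x := by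
  have hcone : ∀ v : E d, inner ℝ (gradient ρ x) v < 0 →
      v ∈ tangentConeAt ℝ (closure Ω) x := fun v hv =>
    mem_tangentConeAt_of_add_smul_mem (tendsto_id'.mpr (nhdsGT_le_nhdsNE 0))
      ((h.eventually_mem hx hv).mono fun t ht => subset_closure ht)
  refine ⟨?_, subset_closure hx.1⟩
  have hn : 0 < ‖gradient ρ x‖ ^ 2 := by have := norm_pos_iff.2 h.1; positivity
  have htop : Submodule.span ℝ (tangentConeAt ℝ (closure Ω) x) = ⊤ := by
    rw [eq_top_iff]
    intro v _
    set n := gradient ρ x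
    set t : ℝ := (1 + |inner ℝ n v|) / ‖n‖ ^ 2
    have ht : t * ‖n‖ ^ 2 = 1 + |inner ℝ n v| := div_mul_cancel₀ _ hn.ne'
    have h1 : inner ℝ n (v - t • n) < 0 := by
      rw [inner_sub_right, inner_smul_right, real_inner_self_eq_norm_sq, ht]
      linarith [le_abs_self (inner ℝ n v)]
    have h2 : inner ℝ n (-(t • n)) < 0 := by
      rw [inner_neg_right, inner_smul_right, real_inner_self_eq_norm_sq, ht]
      linarith [abs_nonneg (inner ℝ n v)]
    have := Submodule.sub_mem _ (Submodule.subset_span (R := ℝ) (hcone _ h1))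
      (Submodule.subset_span (hcone _ h2))
    simpa using this
  rw [htop]
  simp

lemma HasSmoothBoundary.uniqueDiffOn_closure (h : HasSmoothBoundary Ω) (hΩ : IsOpen Ω) :
    UniqueDiffOn ℝ (closure Ω) := by
  intro x hx
  by_cases hxΩ : x ∈ Ω
  · exact (hΩ.uniqueDiffWithinAt hxΩ).mono subset_closure
  · have hf : x ∈ frontier Ω := by rw [frontier, hΩ.interior_eq]; exact ⟨hx, hxΩ⟩
    obtain ⟨ρ, hρ⟩ := h x hf
    exact hρ.uniqueDiffWithinAt hf

/-- A function that vanishes on the boundary has vanishing tangential derivatives: by connectedness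
the short segment from `x + t (τ - δ ∇ρ)`, inside `Ω`, to `x + t (τ + δ ∇ρ)`, outside `Ω`, meets
the boundary. -/
lemma IsDefiningFunctionAt.fderivWithin_apply_eq_zero (h : IsDefiningFunctionAt Ω x ρ)
    (hx : x ∈ frontier Ω) {f : E d → ℝ} {f' : E d →L[ℝ] ℝ}
    (hf : HasFDerivWithinAt f f' (closure Ω) x) (hf0 : ∀ y ∈ frontier Ω, f y = 0)
    {τ : E d} (hτ : inner ℝ (gradient ρ x) τ = 0) : f' τ = 0 := by
  set n := gradient ρ x with hn_def
  have hn : 0 < ‖n‖ ^ 2 := by have := norm_pos_iff.2 h.1; positivity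
  have key : ∀ δ : ℝ, 0 < δ → |f' τ| ≤ δ * (‖f'‖ * ‖n‖ + (‖τ‖ + δ * ‖n‖)) := by
    intro δ hδ
    have h1 := h.eventually_mem hx (v := τ - δ • n) (by
      rw [inner_sub_right, inner_smul_right, real_inner_self_eq_norm_sq, hτ]
      have := mul_pos hδ hn; linarith)
    have h2 := h.eventually_notMem hx (v := τ + δ • n) (by
      rw [inner_add_right, inner_smul_right, real_inner_self_eq_norm_sq, hτ]
      have := mul_pos hδ hn; linarith)
    have h3 := (hasFDerivWithinAt_iff_isLittleO.1 hf).bound hδ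
    rw [eventually_nhdsWithin_iff, Metric.eventually_nhds_iff] at h3
    obtain ⟨ε, hε, h3⟩ := h3
    have h4 : ∀ᶠ t in 𝓝[>] (0 : ℝ), t * (‖τ‖ + δ * ‖n‖) < ε := by
      have : Continuous fun t : ℝ => t * (‖τ‖ + δ * ‖n‖) := by fun_prop
      have h0 := (this.tendsto 0).mono_left (nhdsWithin_le_nhds (s := Ioi 0))
      rw [zero_mul] at h0
      exact h0.eventually (gt_mem_nhds hε)
    obtain ⟨t, h1, h2, h4, ht⟩ := (h1.and (h2.and (h4.and self_mem_nhdsWithin))).exists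
    have ht : 0 < t := ht
    have hseg : IsPreconnected ((fun r : ℝ => x + t • (τ + r • n)) '' Icc (-δ) δ) :=
      isPreconnected_Icc.image _ (by fun_prop)
    obtain ⟨y, ⟨r, hr, rfl⟩, hy⟩ := hseg.exists_mem_frontier (s := Ω)
      ⟨x + t • (τ - δ • n), ⟨-δ, ⟨le_rfl, by linarith⟩, by simp [sub_eq_add_neg]⟩, h1⟩
      ⟨x + t • (τ + δ • n), ⟨δ, ⟨by linarith, le_rfl⟩, rfl⟩, h2⟩
    have hrn : ‖τ + r • n‖ ≤ ‖τ‖ + δ * ‖n‖ := by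
      refine (norm_add_le _ _).trans ?_
      rw [norm_smul, Real.norm_eq_abs]
      have : |r| ≤ δ := abs_le.2 hr
      gcongr
    have h5 := h3 (y := x + t • (τ + r • n)) (by
      rw [dist_eq_norm, add_sub_cancel_left, norm_smul, Real.norm_eq_abs, abs_of_pos ht]
      exact lt_of_le_of_lt (by gcongr) h4) hy.1
    rw [hf0 _ hy, hf0 _ hx, add_sub_cancel_left, norm_smul, map_smul, sub_zero, zero_sub, norm_neg,
      norm_smul, Real.norm_eq_abs, abs_of_pos ht] at h5
    have h6 : ‖f' (τ + r • n)‖ ≤ δ * ‖τ + r • n‖ := by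
      refine le_of_mul_le_mul_left ?_ ht
      linarith
    have h7 : f' τ = f' (τ + r • n) - r * f' n := by simp
    calc |f' τ| ≤ |f' (τ + r • n)| + |r * f' n| := by rw [h7]; exact abs_sub _ _
      _ ≤ δ * (‖τ‖ + δ * ‖n‖) + δ * (‖f'‖ * ‖n‖) := by
          rw [abs_mul]
          have : |r| ≤ δ := abs_le.2 hr
          have h8 : |f' n| ≤ ‖f'‖ * ‖n‖ := f'.le_opNorm n
          refine add_le_add (h6.trans (by gcongr)) (by gcongr)
      _ = _ := by ring
  have hlim : Tendsto (fun δ : ℝ => δ * (‖f'‖ * ‖n‖ + (‖τ‖ + δ * ‖n‖))) (𝓝[>] 0) (𝓝 0) := by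
    have : Continuous fun δ : ℝ => δ * (‖f'‖ * ‖n‖ + (‖τ‖ + δ * ‖n‖)) := by fun_prop
    have h0 := (this.tendsto 0).mono_left (nhdsWithin_le_nhds (s := Ioi 0))
    rwa [zero_mul] at h0
  have := ge_of_tendsto hlim (by filter_upwards [self_mem_nhdsWithin] with δ hδ using key δ hδ)
  exact abs_eq_zero.1 (le_antisymm this (abs_nonneg _))

/-- The two boundary conditions together say that the whole gradient vanishes at the boundary: by
the first it is a multiple of the normal, and by ellipticity the second makes the factor zero. -/
lemma IsC2WithZeroCauchyData.gradientWithin_eq_zero {A : E d → Matrix (Fin d) (Fin d) ℝ}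
    (hA : IsEllipticCoefficient A) {u : E d → ℝ} (hu : IsC2WithZeroCauchyData A Ω u)
    (hS : HasSmoothBoundary Ω) (hx : x ∈ frontier Ω) : gradientWithin u (closure Ω) x = 0 := by
  obtain ⟨ρ, hρ⟩ := hS x hx
  have hd : DifferentiableWithinAt ℝ u (closure Ω) x :=
    (hu.contDiffOn x hx.1).differentiableWithinAt (by norm_num)
  have hg := hd.hasGradientWithinAt
  set G := gradientWithin u (closure Ω) x
  set n := gradient ρ x
  have hn := hρ.1
  have hn2 : 0 < ‖n‖ ^ 2 := by have := norm_pos_iff.2 hn; positivity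
  have htan : ∀ τ : E d, inner ℝ n τ = 0 → inner ℝ G τ = 0 := fun τ hτ => by
    simpa using hρ.fderivWithin_apply_eq_zero hx hg.hasFDerivWithinAt hu.dirichlet hτ
  obtain ⟨k, hk⟩ : ∃ k : ℝ, k * ‖n‖ ^ 2 = inner ℝ G n := ⟨_, div_mul_cancel₀ _ hn2.ne'⟩
  have hGk : G = k • n := by
    have h1 : inner ℝ n (G - k • n) = 0 := by
      rw [inner_sub_right, inner_smul_right, real_inner_self_eq_norm_sq, hk, real_inner_comm,
        sub_self]
    have h2 := htan _ h1
    have h3 : inner ℝ (G - k • n) (G - k • n) = 0 := by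
      rw [inner_sub_left, inner_smul_left, h1, h2]; simp
    exact sub_eq_zero.1 (inner_self_eq_zero.1 h3)
  obtain ⟨μ, hμ, hell⟩ := hA.elliptic
  have hc := hu.conormal x hx _ ⟨ρ, hρ, rfl⟩
  rw [inner_smul_right, mul_eq_zero] at hc
  have hc' := hc.resolve_left (by simpa using hn)
  have h3 : inner ℝ (mulVecE (A x) G) G = 0 := by
    conv_lhs => rw [hGk, inner_smul_right]
    rw [← hGk, hc', mul_zero]
  have h4 := hell x G
  rw [h3] at h4
  have : ‖G‖ ^ 2 ≤ 0 := nonpos_of_mul_nonpos_right h4 hμ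
  exact norm_eq_zero.1 (pow_eq_zero_iff (by norm_num) |>.1 (le_antisymm this (by positivity)))

end Boundary

/-! ### The divergence identity -/

section Identity

variable {d : ℕ}

lemma divergence_smul {f : E d → ℝ} {f' : E d →L[ℝ] ℝ} {V : E d → E d} {x : E d}
    (hf : HasFDerivAt f f' x) (hV : DifferentiableAt ℝ V x) :
    divergence (fun y => f y • V y) x = f x * divergence V x + f' (V x) := by
  have h : HasFDerivAt (fun y => f y • V y) _ x := hf.smul hV.hasFDerivAt
  rw [h.divergence_eq, hV.hasFDerivAt.divergence_eq]
  have hsum : f' (V x) = ∑ i, f' (EuclideanSpace.single i 1) * V x i := by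
    conv_lhs => rw [← (EuclideanSpace.basisFun (Fin d) ℝ).sum_repr (V x)]
    simp [mul_comm]
  rw [hsum, Finset.mul_sum, ← Finset.sum_add_distrib]
  refine Finset.sum_congr rfl fun i _ => ?_
  simp

lemma divergence_add {V₁ V₂ : E d → E d} {x : E d} (h₁ : DifferentiableAt ℝ V₁ x)
    (h₂ : DifferentiableAt ℝ V₂ x) :
    divergence (fun y => V₁ y + V₂ y) x = divergence V₁ x + divergence V₂ x := by
  have h : HasFDerivAt (fun y => V₁ y + V₂ y) _ x := h₁.hasFDerivAt.add h₂.hasFDerivAt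
  rw [h.divergence_eq, h₁.hasFDerivAt.divergence_eq,
    h₂.hasFDerivAt.divergence_eq, ← Finset.sum_add_distrib]
  simp

/-- The vector field whose divergence is `div (A ∇u)` times a first order multiplier of `u`, up to
a quadratic form in `u` and `∇u`. Here `G` stands for `∇u`, `w` for `A ∇ψ`, and `B` is a field with
`B · ∇ψ = 1`; the coefficients `g`, `c`, `b` are functions of `ψ`. -/
noncomputable def carlemanField (u : E d → ℝ) (G : E d → E d) (𝒜 : E d → E d →L[ℝ] E d) (B w : E d → E d)
    (ψ : E d → ℝ) (g c b : ℝ → ℝ) (y : E d) : E d :=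
  (2 * g (ψ y) * inner ℝ (B y) (G y) + c (ψ y) * u y) • 𝒜 y (G y)
    + (-(g (ψ y) * inner ℝ (𝒜 y (G y)) (G y))) • B y
    + (b (ψ y) * u y ^ 2) • w y

/-- The second derivatives of `u` cancel, except for those in `div (A ∇u)`, because the Hessian of
`u` and the matrix `A` are symmetric. -/
lemma divergence_carlemanField {u : E d → ℝ} {G : E d → E d} {G' : E d →L[ℝ] E d}
    {𝒜 : E d → E d →L[ℝ] E d} {𝒜' : E d →L[ℝ] E d →L[ℝ] E d} {B w : E d → E d}
    {B' w' : E d →L[ℝ] E d} {ψ : E d → ℝ} {ψ' : E d →L[ℝ] ℝ} {g c b : ℝ → ℝ}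
    {g' c' b' Q : ℝ} {x : E d}
    (hu : HasFDerivAt u (innerSL ℝ (G x)) x) (hG : HasFDerivAt G G' x)
    (hsymm : ∀ h k, inner ℝ (G' h) k = inner ℝ (G' k) h)
    (h𝒜 : HasFDerivAt 𝒜 𝒜' x) (hA : ∀ h k, inner ℝ (𝒜 x h) k = inner ℝ h (𝒜 x k))
    (hB : HasFDerivAt B B' x) (hw : HasFDerivAt w w' x) (hψ : HasFDerivAt ψ ψ' x)
    (hψB : ψ' (B x) = 1) (hψA : ∀ h, ψ' (𝒜 x h) = inner ℝ (w x) h) (hψw : ψ' (w x) = Q)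
    (hwB : w x = Q • B x)
    (hg : HasDerivAt g g' (ψ x)) (hc : HasDerivAt c c' (ψ x)) (hb : HasDerivAt b b' (ψ x)) :
    divergence (carlemanField u G 𝒜 B w ψ g c b) x
      = divergence (fun y => 𝒜 y (G y)) x
          * (2 * g (ψ x) * inner ℝ (B x) (G x) + c (ψ x) * u x)
        + 2 * g' * Q * inner ℝ (B x) (G x) ^ 2
        + (c (ψ x) - g') * inner ℝ (𝒜 x (G x)) (G x)
        + (c' + 2 * b (ψ x)) * Q * u x * inner ℝ (B x) (G x)
        + b' * Q * u x ^ 2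
        + g (ψ x) * (2 * inner ℝ (B' (𝒜 x (G x))) (G x)
            - inner ℝ (𝒜 x (G x)) (G x) * divergence B x - inner ℝ (𝒜' (B x) (G x)) (G x))
        + b (ψ x) * u x ^ 2 * divergence w x := by
  have hW := h𝒜.clm_apply hG
  have hs := hB.inner ℝ hG
  have hT := hW.inner ℝ hG
  have hg2 := hg.comp_hasFDerivAt x hψ
  have hc2 := hc.comp_hasFDerivAt x hψ
  have hb2 := hb.comp_hasFDerivAt x hψ
  have h1 := ((hg2.const_mul 2).mul hs).add (hc2.mul hu)
  have h2 := (hg2.mul hT).neg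
  have h3 := hb2.mul (hu.pow 2)
  have e1 := divergence_smul h1 hW.differentiableAt
  have e2 := divergence_smul h2 hB.differentiableAt
  have e3 := divergence_smul h3 hw.differentiableAt
  have d1 := (h1.smul hW).differentiableAt
  have d2 := (h2.smul hB).differentiableAt
  have d3 := (h3.smul hw).differentiableAt
  have e4 := divergence_add (d1.add d2) d3
  have e5 := divergence_add d1 d2
  have hF : divergence (carlemanField u G 𝒜 B w ψ g c b) x = _ := e4.trans
    (congrArg₂ (· + ·) (e5.trans (congrArg₂ (· + ·) e1 e2)) e3)
  rw [hF]
  have k1 := hsymm (𝒜 x (G x)) (B x)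
  have k2 := hA (G' (B x)) (G x)
  have k3 : inner ℝ (G x) (w x) = Q * inner ℝ (B x) (G x) := by
    rw [hwB, inner_smul_right, real_inner_comm]
  have k4 : inner ℝ (w x) (G x) = Q * inner ℝ (B x) (G x) := by
    rw [real_inner_comm, k3]
  have k5 := real_inner_comm (G' (B x)) (𝒜 x (G x))
  have k6 := real_inner_comm (B x) (G' (𝒜 x (G x)))
  have k7 := real_inner_comm (G x) (𝒜 x (G x))
  simp [fderivInnerCLM_apply, hψB, hψA, hψw, inner_add_left, k3, k4]
  linear_combination (-2 * g (ψ x)) * k6 + 2 * g (ψ x) * k1 - c (ψ x) * k7 - g (ψ x) * k5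
    - g (ψ x) * k2

end Identity

/-! ### The coefficients of the multiplier and the pointwise inequality -/

section Scalar

/-- The exponent `λ ψ^(-p)` of the weight as a function of `y = ψ`. -/
noncomputable def zeta (l p y : ℝ) : ℝ := l * y ^ (-p)

/-- The coefficient of the energy term `u div (A ∇u)`. The term `-10 z` makes it concave enough for
small `z` to produce a positive multiple of `u²` there, which the weight alone does not. -/
noncomputable def chi (z : ℝ) : ℝ := 100 - 10 * z + Real.exp (2 * z) / 4

/-- The coefficient of `∇u` in the multiplier, as a function of `y = ψ`. -/
noncomputable def coefG (l p y : ℝ) : ℝ := -(p * y * Real.exp (2 * zeta l p y))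

/-- The coefficient of `u` in the multiplier, as a function of `y = ψ`. Its first term cancels the
large term `-g' A ∇u · ∇u` that the first order part of the multiplier produces. -/
noncomputable def coefC (l p y : ℝ) : ℝ :=
  2 * p ^ 2 * zeta l p y * Real.exp (2 * zeta l p y) + p ^ 2 * chi (zeta l p y)

/-- The coefficient of `u² A ∇ψ` in `carlemanField`, up to the factor `p³ / ψ`, in terms of
`z = λ ψ^(-p)`. It is chosen so that the mixed term in `u` and `B · ∇u` completes a square. -/
noncomputable def beta (z : ℝ) : ℝ := (5 / 4 * z - 2 * z ^ 2) * Real.exp (2 * z) - 5 * z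

/-- The coefficient of `u² A ∇ψ` in `carlemanField`, as a function of `y = ψ`. -/
noncomputable def coefB (l p y : ℝ) : ℝ := p ^ 3 / y * beta (zeta l p y)

variable {l p y : ℝ}

lemma hasDerivAt_zeta (hy : 0 < y) : HasDerivAt (zeta l p) (-(p * zeta l p y / y)) y := by
  have := (Real.hasDerivAt_rpow_const (p := -p) (Or.inl hy.ne')).const_mul l
  refine this.congr_deriv ?_
  rw [zeta, Real.rpow_sub_one hy.ne']
  ring

lemma hasDerivAt_coefG (hy : 0 < y) : HasDerivAt (coefG l p)
    (Real.exp (2 * zeta l p y) * (2 * p ^ 2 * zeta l p y - p)) y := by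
  have hz := hasDerivAt_zeta (l := l) (p := p) hy
  have := (((hasDerivAt_id y).const_mul p).mul (hz.const_mul 2).exp).neg
  refine this.congr_deriv ?_
  simp only [id]
  field_simp
  ring

lemma hasDerivAt_coefC (hy : 0 < y) : HasDerivAt (coefC l p)
    (-(p ^ 3 / y * ((5 / 2 * zeta l p y + 4 * zeta l p y ^ 2) * Real.exp (2 * zeta l p y)
      - 10 * zeta l p y))) y := by
  have hz := hasDerivAt_zeta (l := l) (p := p) hy
  have he := (hz.const_mul 2).exp
  have := ((hz.const_mul (2 * p ^ 2)).mul he).add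
    ((((hz.const_mul 10).const_sub 100).add (he.div_const 4)).const_mul (p ^ 2))
  refine this.congr_deriv ?_
  field_simp
  ring

lemma hasDerivAt_coefB (hy : 0 < y) : HasDerivAt (coefB l p)
    (-(p ^ 3 / y ^ 2 * (beta (zeta l p y)
      + p * ((5 / 4 * zeta l p y - 3 / 2 * zeta l p y ^ 2 - 4 * zeta l p y ^ 3)
        * Real.exp (2 * zeta l p y) - 5 * zeta l p y)))) y := by
  have hz := hasDerivAt_zeta (l := l) (p := p) hy
  have he := (hz.const_mul 2).exp
  have := ((hasDerivAt_id y).fun_inv hy.ne').const_mul (p ^ 3) |>.mul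
    (((((hz.const_mul (5 / 4)).sub ((hz.pow 2).const_mul 2)).mul he)).sub (hz.const_mul 5))
  refine (this.congr_deriv ?_).congr_of_eventuallyEq (Eventually.of_forall fun t => ?_)
  · simp [beta]
    field_simp
    ring
  · simp [coefB, beta, div_eq_mul_inv]

lemma chi_le {z : ℝ} (hz : 0 < z) : chi z ≤ 101 * Real.exp (2 * z) := by
  have := Real.one_le_exp (x := 2 * z) (by linarith)
  rw [chi]; linarith

lemma le_chi {z : ℝ} (hz : 0 < z) : Real.exp (2 * z) / 8 ≤ chi z := by
  have := Real.quadratic_le_exp_of_nonneg (x := 2 * z) (by linarith)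
  rw [chi]; nlinarith [sq_nonneg (z - 20)]

lemma abs_beta_le {z : ℝ} (hz : 0 < z) : |beta z| ≤ 7 * Real.exp (2 * z) * (z + z ^ 2) := by
  have h1 := Real.one_le_exp (x := 2 * z) (by linarith)
  have h2 : z * 1 ≤ z * Real.exp (2 * z) := by gcongr
  have h3 : 0 < z ^ 2 * Real.exp (2 * z) := by positivity
  rw [beta, abs_le]
  constructor <;> nlinarith

/-- The coefficient of `u²` left after completing the square is positive for every `z`. -/
lemma le_zeroOrder {z : ℝ} (hz : 0 < z) :
    (z + z ^ 2) / 4 * Real.exp (2 * z)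
      ≤ (3 / 2 * z ^ 2 - 5 / 4 * z) * Real.exp (2 * z) + 5 * z := by
  have h1 : (3 / 2 - 5 / 4 * z) * Real.exp (2 * z) ≤ 5 := by
    -- the left side is at most its maximum, which is attained at `z = 7 / 10`
    have h2 := Real.add_one_le_exp (7 / 5 - 2 * z)
    have h3 : Real.exp (7 / 5 - 2 * z) * Real.exp (2 * z) = Real.exp (7 / 5) := by
      rw [← Real.exp_add]; congr 1; ring
    have h4 : Real.exp (7 / 5) ≤ 8 := by
      have h5 : Real.exp (7 / 5) ≤ Real.exp (1 + 1) := Real.exp_le_exp.2 (by norm_num)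
      rw [Real.exp_add] at h5
      have h6 := Real.exp_one_lt_d9
      have h7 := Real.exp_pos 1
      nlinarith
    have h8 := Real.exp_pos (2 * z)
    nlinarith
  nlinarith

set_option maxHeartbeats 1000000 in
/-- `pointwise_le` with the values of the exponential, of `chi` and of `beta` as variables that
satisfy the bounds proved above. -/
lemma pointwise_le_aux {M K μ q L u N s T Q e D : ℝ} (hK : 0 < K) (hμ : 0 < μ)
    (hq : 0 < q) {z a χ β : ℝ} (hz : 0 < z) (ha : 0 < a) (hp : 1 ≤ p) (hy : 0 < y) (hyM : y ≤ M)
    (hp1 : 16 * (2 * K ^ 3 + M * K) / μ ≤ p) (hp2 : 16 * (7 * K * (1 + M)) / q ≤ p)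
    (hqQ : q ≤ Q) (hQK : Q ≤ K) (hs : |s| ≤ K * N) (hT : μ * N ^ 2 ≤ T)
    (he : |e| ≤ K * N ^ 2) (hD : |D| ≤ K)
    (hχ1 : χ ≤ 101 * a) (hχ2 : a / 8 ≤ χ) (hβ : |β| ≤ 7 * a * (z + z ^ 2))
    (hβ0 : β = (5 / 4 * z - 2 * z ^ 2) * a - 5 * z)
    (hz0 : (z + z ^ 2) / 4 * a ≤ (3 / 2 * z ^ 2 - 5 / 4 * z) * a + 5 * z) :
    p ^ 2 * a * (μ / 16) * N ^ 2
      + p ^ 4 / y ^ 2 * (q / 8) * a * z ^ 2 * u ^ 2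
    ≤ 50000 / q * (y ^ 2 / z * a * L ^ 2)
      + (L * (2 * -(p * y * a) * s + (2 * p ^ 2 * z * a + p ^ 2 * χ) * u)
        + 2 * (a * (2 * p ^ 2 * z - p)) * Q * s ^ 2
        + ((2 * p ^ 2 * z * a + p ^ 2 * χ) - a * (2 * p ^ 2 * z - p)) * T
        + (-(p ^ 3 / y * ((5 / 2 * z + 4 * z ^ 2) * a
            - 10 * z)) + 2 * (p ^ 3 / y * β)) * Q * u * s
        + -(p ^ 3 / y ^ 2 * (β
            + p * ((5 / 4 * z - 3 / 2 * z ^ 2 - 4 * z ^ 3)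
              * a - 5 * z))) * Q * u ^ 2
        + -(p * y * a) * e + (p ^ 3 / y * β) * u ^ 2 * D) := by
  have hp0 : 0 < p := by linarith
  have hQ : 0 < Q := by linarith
  -- up to the factor `ψ e^{-z} / p`, `r` is the derivative of `e^z u` along `B`
  obtain ⟨r, hr⟩ : ∃ r, s = p / y * (r + z * u) := ⟨y / p * s - z * u, by field_simp; ring⟩
  set P := p ^ 4 / y ^ 2 with hP
  have hP0 : 0 < P := by positivity
  have main : 4 * p ^ 2 * z * a * Q * s ^ 2
      + (-(p ^ 3 / y * ((5 / 2 * z + 4 * z ^ 2) * a - 10 * z)) + 2 * (p ^ 3 / y * β))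
        * Q * u * s
      - p ^ 3 / y ^ 2 * (p * ((5 / 4 * z - 3 / 2 * z ^ 2 - 4 * z ^ 3) * a - 5 * z)) * Q * u ^ 2
      = P * Q * (4 * z * a * r ^ 2) + P * Q * u ^ 2 * ((3 / 2 * z ^ 2 - 5 / 4 * z) * a + 5 * z) := by
    rw [hr, hP, hβ0]
    field_simp
    ring
  have mult : 2 * -(p * y * a) * s + (2 * p ^ 2 * z * a + p ^ 2 * χ) * u
      = -(2 * p ^ 2 * a * r) + p ^ 2 * χ * u := by
    rw [hr]; field_simp; ring
  -- Young's inequality for the two parts of the multiplier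
  have y1 : L * (2 * p ^ 2 * a * r) ≤ P * Q * (4 * z * a * r ^ 2) + y ^ 2 / z * a * L ^ 2 / Q := by
    have : P * Q * (4 * z * a * r ^ 2) + y ^ 2 / z * a * L ^ 2 / Q - L * (2 * p ^ 2 * a * r)
        = a * (3 * P * Q * z * r ^ 2 + (p ^ 2 * Q * z * r - y ^ 2 * L) ^ 2 / (y ^ 2 * Q * z)) := by
      rw [hP]; field_simp; ring
    have : 0 ≤ a * (3 * P * Q * z * r ^ 2
        + (p ^ 2 * Q * z * r - y ^ 2 * L) ^ 2 / (y ^ 2 * Q * z)) := by positivity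
    linarith
  have y2 : -(L * (p ^ 2 * χ * u))
      ≤ P * Q * u ^ 2 * (z * a / 16) + 40804 * (y ^ 2 / z * a * L ^ 2 / Q) := by
    have h1 : -(L * (p ^ 2 * χ * u)) ≤ 101 * a * p ^ 2 * (|L| * |u|) := by
      have : -(L * (p ^ 2 * χ * u)) ≤ |L * (p ^ 2 * χ * u)| := neg_le_abs _
      refine this.trans ?_
      have hχ0 : 0 ≤ χ := by linarith
      rw [abs_mul, abs_mul, abs_of_nonneg (by positivity : 0 ≤ p ^ 2 * χ)]
      calc |L| * (p ^ 2 * χ * |u|) = χ * (p ^ 2 * (|L| * |u|)) := by ring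
        _ ≤ 101 * a * (p ^ 2 * (|L| * |u|)) := by gcongr
        _ = _ := by ring
    have h2 : P * Q * u ^ 2 * (z * a / 16) + 40804 * (y ^ 2 / z * a * L ^ 2 / Q)
        - 101 * a * p ^ 2 * (|L| * |u|)
        = a * (p ^ 2 * Q * z * |u| / 4 - 202 * y ^ 2 * |L|) ^ 2 / (y ^ 2 * Q * z) := by
      rw [hP, ← sq_abs u, ← sq_abs L]; field_simp; ring
    have : 0 ≤ a * (p ^ 2 * Q * z * |u| / 4 - 202 * y ^ 2 * |L|) ^ 2 / (y ^ 2 * Q * z) := by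
      positivity
    linarith
  have y3 : y ^ 2 / z * a * L ^ 2 / Q ≤ y ^ 2 / z * a * L ^ 2 / q := by gcongr
  -- the terms of lower order in `p`
  have e1 : 2 * p * a * Q * s ^ 2 ≤ p * a * (2 * K ^ 3) * N ^ 2 := by
    have : s ^ 2 ≤ (K * N) ^ 2 := by rw [← sq_abs]; gcongr
    calc 2 * p * a * Q * s ^ 2 ≤ 2 * p * a * K * (K * N) ^ 2 := by gcongr
      _ = _ := by ring
  have e2 : p * y * a * e ≤ p * a * (M * K) * N ^ 2 := by
    calc p * y * a * e ≤ p * y * a * (K * N ^ 2) := by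
          gcongr
          exact (le_abs_self e).trans he
      _ ≤ p * M * a * (K * N ^ 2) := by gcongr
      _ = _ := by ring
  have e3 : p ^ 3 / y ^ 2 * β * Q * u ^ 2
      ≤ p ^ 3 / y ^ 2 * (7 * a * (z + z ^ 2)) * K * u ^ 2 := by
    have h1 : β * Q ≤ (7 * a * (z + z ^ 2)) * K :=
      (mul_le_mul_of_nonneg_right ((le_abs_self _).trans hβ) hQ.le).trans (by gcongr)
    calc p ^ 3 / y ^ 2 * β * Q * u ^ 2 = p ^ 3 / y ^ 2 * u ^ 2 * (β * Q) := by ring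
      _ ≤ p ^ 3 / y ^ 2 * u ^ 2 * ((7 * a * (z + z ^ 2)) * K) := by gcongr
      _ = _ := by ring
  have e4 : -(p ^ 3 / y * β * u ^ 2 * D)
      ≤ p ^ 3 / y ^ 2 * (7 * a * (z + z ^ 2)) * (K * M) * u ^ 2 := by
    have h1 : -(β * D) ≤ 7 * a * (z + z ^ 2) * K := by
      refine (neg_le_abs _).trans ?_
      rw [abs_mul]
      gcongr
    have h2 : p ^ 3 / y ≤ p ^ 3 / y ^ 2 * M := by
      rw [div_mul_eq_mul_div, div_le_div_iff₀ hy (by positivity)]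
      have : p ^ 3 * y ^ 2 ≤ p ^ 3 * (M * y) := by
        rw [pow_two]; gcongr
      exact this.trans_eq (by ring)
    calc -(p ^ 3 / y * β * u ^ 2 * D) = p ^ 3 / y * u ^ 2 * (-(β * D)) := by ring
      _ ≤ p ^ 3 / y * u ^ 2 * (7 * a * (z + z ^ 2) * K) := by gcongr
      _ ≤ p ^ 3 / y ^ 2 * M * u ^ 2 * (7 * a * (z + z ^ 2) * K) := by gcongr
      _ = _ := by ring
  have f1 : p * a * (2 * K ^ 3 + M * K) * N ^ 2 ≤ p ^ 2 * a * (μ / 16) * N ^ 2 := by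
    rw [div_le_iff₀ hμ] at hp1
    have : 2 * K ^ 3 + M * K ≤ p * (μ / 16) := by linarith
    calc p * a * (2 * K ^ 3 + M * K) * N ^ 2 ≤ p * a * (p * (μ / 16)) * N ^ 2 := by gcongr
      _ = _ := by ring
  have f2 : p ^ 3 / y ^ 2 * (7 * a * (z + z ^ 2)) * (K * (1 + M)) * u ^ 2
      ≤ P * (q / 16) * (a * (z + z ^ 2)) * u ^ 2 := by
    rw [div_le_iff₀ hq] at hp2
    have : 7 * K * (1 + M) ≤ p * (q / 16) := by linarith
    calc p ^ 3 / y ^ 2 * (7 * a * (z + z ^ 2)) * (K * (1 + M)) * u ^ 2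
        = p ^ 3 / y ^ 2 * a * (z + z ^ 2) * (7 * K * (1 + M)) * u ^ 2 := by ring
      _ ≤ p ^ 3 / y ^ 2 * a * (z + z ^ 2) * (p * (q / 16)) * u ^ 2 := by gcongr
      _ = _ := by rw [hP]; ring
  have f3 : p ^ 2 * (a / 8) * (μ * N ^ 2) ≤ p ^ 2 * χ * T := by
    have : 0 ≤ χ := (by positivity : 0 ≤ a / 8).trans hχ2
    gcongr
  have f4 : 0 ≤ p * a * T := by
    have : 0 ≤ T := (by positivity : 0 ≤ μ * N ^ 2).trans hT
    positivity
  have f5 : P * Q * u ^ 2 * ((z + z ^ 2) / 4 * a)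
      ≤ P * Q * u ^ 2 * ((3 / 2 * z ^ 2 - 5 / 4 * z) * a + 5 * z) := by gcongr
  have f6 : P * (q / 16) * (a * (z + z ^ 2)) * u ^ 2 + P * (q / 8) * a * z ^ 2 * u ^ 2
      ≤ P * Q * u ^ 2 * ((z + z ^ 2) / 4 * a) - P * Q * u ^ 2 * (z * a / 16) := by
    have h1 : P * (q / 16) * (a * (z + z ^ 2)) * u ^ 2 + P * (q / 8) * a * z ^ 2 * u ^ 2
        = P * u ^ 2 * a * (z / 16 + 3 / 16 * z ^ 2) * q := by ring
    have h2 : P * Q * u ^ 2 * ((z + z ^ 2) / 4 * a) - P * Q * u ^ 2 * (z * a / 16)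
        = P * u ^ 2 * a * (3 / 16 * z + 1 / 4 * z ^ 2) * Q := by ring
    rw [h1, h2]
    have : z / 16 + 3 / 16 * z ^ 2 ≤ 3 / 16 * z + 1 / 4 * z ^ 2 := by
      have := sq_nonneg z
      linarith
    gcongr
  have g1 : 0 ≤ y ^ 2 / z * a * L ^ 2 / q := by positivity
  have g2 : 50000 / q * (y ^ 2 / z * a * L ^ 2) = 50000 * (y ^ 2 / z * a * L ^ 2 / q) := by ring
  rw [mult, g2]
  have g3 : p ^ 3 / y ^ 2 * (7 * a * (z + z ^ 2)) * (K * (1 + M)) * u ^ 2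
      = p ^ 3 / y ^ 2 * (7 * a * (z + z ^ 2)) * K * u ^ 2
        + p ^ 3 / y ^ 2 * (7 * a * (z + z ^ 2)) * (K * M) * u ^ 2 := by ring
  linarith

/-- The pointwise Carleman inequality. The variables stand for `div (A ∇u)`, `u`, `|∇u|`,
`B · ∇u`, `A ∇u · ∇u`, `A ∇ψ · ∇ψ`, a quadratic form in `∇u`, and `div (A ∇ψ)`. All terms
without a sign are of relative size `1 / p`. -/
lemma pointwise_le {M K μ q L u N s T Q e D : ℝ} (hK : 0 < K) (hμ : 0 < μ)
    (hq : 0 < q) (hl : 0 < l) (hp : 1 ≤ p) (hy : 0 < y) (hyM : y ≤ M)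
    (hp1 : 16 * (2 * K ^ 3 + M * K) / μ ≤ p) (hp2 : 16 * (7 * K * (1 + M)) / q ≤ p)
    (hqQ : q ≤ Q) (hQK : Q ≤ K) (hs : |s| ≤ K * N) (hT : μ * N ^ 2 ≤ T)
    (he : |e| ≤ K * N ^ 2) (hD : |D| ≤ K) :
    p ^ 2 * Real.exp (2 * zeta l p y) * (μ / 16) * N ^ 2
      + p ^ 4 / y ^ 2 * (q / 8) * Real.exp (2 * zeta l p y) * zeta l p y ^ 2 * u ^ 2
    ≤ 50000 / q * (y ^ 2 / zeta l p y * Real.exp (2 * zeta l p y) * L ^ 2)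
      + (L * (2 * coefG l p y * s + coefC l p y * u)
        + 2 * (Real.exp (2 * zeta l p y) * (2 * p ^ 2 * zeta l p y - p)) * Q * s ^ 2
        + (coefC l p y - Real.exp (2 * zeta l p y) * (2 * p ^ 2 * zeta l p y - p)) * T
        + (-(p ^ 3 / y * ((5 / 2 * zeta l p y + 4 * zeta l p y ^ 2) * Real.exp (2 * zeta l p y)
            - 10 * zeta l p y)) + 2 * coefB l p y) * Q * u * s
        + -(p ^ 3 / y ^ 2 * (beta (zeta l p y)
            + p * ((5 / 4 * zeta l p y - 3 / 2 * zeta l p y ^ 2 - 4 * zeta l p y ^ 3)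
              * Real.exp (2 * zeta l p y) - 5 * zeta l p y))) * Q * u ^ 2
        + coefG l p y * e + coefB l p y * u ^ 2 * D) := by
  have hz : 0 < zeta l p y := by rw [zeta]; positivity
  exact pointwise_le_aux hK hμ hq hz (Real.exp_pos _) hp hy hyM hp1 hp2 hqQ hQK hs hT he hD
    (chi_le hz) (le_chi hz) (abs_beta_le hz) rfl (le_zeroOrder hz)

end Scalar

/-! ### The coefficients of the operator and of the weight -/

section Coefficients

variable {d : ℕ} {A : E d → Matrix (Fin d) (Fin d) ℝ}

/-- The matrix field `A` as a field of continuous linear maps. -/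
noncomputable def opA (A : E d → Matrix (Fin d) (Fin d) ℝ) (x : E d) : E d →L[ℝ] E d :=
  Matrix.toEuclideanCLM (n := Fin d) (𝕜 := ℝ) (A x)

lemma opA_apply (x v : E d) : opA A x v = mulVecE (A x) v := rfl

lemma opA_apply_apply (x v : E d) (i : Fin d) : opA A x v i = ∑ j, A x i j * v j := rfl

lemma IsEllipticCoefficient.contDiff_opA (hA : IsEllipticCoefficient A) :
    ContDiff ℝ 2 (opA A) := by
  refine contDiff_clm_apply_iff.2 fun v => contDiff_euclidean.2 fun i => ?_
  simp only [opA_apply_apply]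
  exact ContDiff.sum fun j _ => (hA.contDiff i j).mul contDiff_const

lemma IsEllipticCoefficient.inner_opA (hA : IsEllipticCoefficient A) (x h k : E d) :
    inner ℝ (opA A x h) k = inner ℝ h (opA A x k) := by
  simp only [PiLp.inner_apply, opA_apply_apply, RCLike.inner_apply, conj_trivial, Finset.mul_sum,
    Finset.sum_mul]
  rw [Finset.sum_comm]
  refine Finset.sum_congr rfl fun i _ => Finset.sum_congr rfl fun j _ => ?_
  have : A x j i = A x i j := congrFun (congrFun (hA.symm x) i) j
  rw [this]; ring

variable [NeZero d]

/-- The gradient of `ψ`. -/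
noncomputable def gradPsi (X : ℝ) (x : E d) : E d :=
  EuclideanSpace.single 0 1 + (1 / X ^ 2) • x

lemma psi_eq (X α : ℝ) (x : E d) :
    psi X α x = inner ℝ (EuclideanSpace.single 0 1) x + 1 / (2 * X ^ 2) * ‖x‖ ^ 2 + α := by
  rw [psi, EuclideanSpace.real_norm_sq_eq, EuclideanSpace.inner_single_left]
  simp

lemma contDiff_psi {n : WithTop ℕ∞} (X α : ℝ) : ContDiff ℝ n (psi (d := d) X α) := by
  have : psi (d := d) X α = fun x =>
      inner ℝ (EuclideanSpace.single 0 1) x + 1 / (2 * X ^ 2) * ‖x‖ ^ 2 + α :=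
    funext (psi_eq X α)
  rw [this]
  exact ((contDiff_const.inner ℝ contDiff_id).add
    (contDiff_const.mul (contDiff_norm_sq ℝ))).add contDiff_const

lemma hasFDerivAt_psi (X α : ℝ) (x : E d) :
    HasFDerivAt (psi X α) (innerSL ℝ (gradPsi X x)) x := by
  have : psi (d := d) X α = fun x =>
      inner ℝ (EuclideanSpace.single 0 1) x + 1 / (2 * X ^ 2) * ‖x‖ ^ 2 + α :=
    funext (psi_eq X α)
  rw [this]
  have h1 := (innerSL ℝ (EuclideanSpace.single (0 : Fin d) (1 : ℝ))).hasFDerivAt (x := x)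
  have h2 := (hasStrictFDerivAt_norm_sq x).hasFDerivAt.const_mul (1 / (2 * X ^ 2))
  refine ((h1.add h2).add_const α).congr_fderiv ?_
  ext v
  simp [gradPsi]
  ring

lemma contDiff_gradPsi {n : WithTop ℕ∞} (X : ℝ) : ContDiff ℝ n (gradPsi (d := d) X) :=
  contDiff_const.add (contDiff_id.const_smul _)

/-- The only critical point of `ψ` is `(-X², 0, …, 0)`, which is at a distance from the paraboloid
strip. -/
lemma le_norm_gradPsi {X : ℝ} (hX : 0 < X) {x : E d} (hx : x ∈ paraboloidStrip d X) :
    3 / 4 ≤ ‖gradPsi X x‖ ^ 2 := by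
  have h1 : ‖gradPsi X x‖ ^ 2 = 1 + 2 * (1 / X ^ 2) * x 0 + (1 / X ^ 2) ^ 2 * ‖x‖ ^ 2 := by
    rw [gradPsi, norm_add_sq_real, inner_smul_right, EuclideanSpace.inner_single_left, norm_smul,
      mul_pow, Real.norm_eq_abs, sq_abs]
    simp
    ring
  have h2 : ‖x‖ ^ 2 = x 0 ^ 2 + ∑ i ∈ Finset.univ.erase 0, (x i) ^ 2 := by
    rw [EuclideanSpace.real_norm_sq_eq, Finset.add_sum_erase _ (fun i => x i ^ 2) (Finset.mem_univ 0)]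
  have h3 := hx.1
  rw [h1, h2]
  set S := ∑ i ∈ Finset.univ.erase 0, (x i) ^ 2
  have hk : 0 < 1 / X ^ 2 := by positivity
  rw [← one_div] at h3
  set k := 1 / X ^ 2
  have h4 := mul_pos hk h3
  nlinarith [sq_nonneg (k * x 0 + 1 / 2)]

/-- The conormal field `A ∇ψ`. -/
noncomputable def fieldW (A : E d → Matrix (Fin d) (Fin d) ℝ) (X : ℝ) (x : E d) : E d :=
  opA A x (gradPsi X x)

/-- The quantity `A ∇ψ · ∇ψ`. -/
noncomputable def fieldQ (A : E d → Matrix (Fin d) (Fin d) ℝ) (X : ℝ) (x : E d) : ℝ :=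
  inner ℝ (gradPsi X x) (fieldW A X x)

/-- The field `A ∇ψ / (A ∇ψ · ∇ψ)`, which has `B · ∇ψ = 1` away from critical points of `ψ`. -/
noncomputable def fieldB (A : E d → Matrix (Fin d) (Fin d) ℝ) (X : ℝ) (x : E d) : E d :=
  (fieldQ A X x)⁻¹ • fieldW A X x

lemma IsEllipticCoefficient.contDiff_fieldW (hA : IsEllipticCoefficient A) (X : ℝ) :
    ContDiff ℝ 2 (fieldW A X) :=
  hA.contDiff_opA.clm_apply (contDiff_gradPsi X)

lemma IsEllipticCoefficient.contDiff_fieldQ (hA : IsEllipticCoefficient A) (X : ℝ) :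
    ContDiff ℝ 2 (fieldQ A X) :=
  (contDiff_gradPsi X).inner ℝ (hA.contDiff_fieldW X)

lemma IsEllipticCoefficient.contDiffOn_fieldB (hA : IsEllipticCoefficient A) (X : ℝ) :
    ContDiffOn ℝ 2 (fieldB A X) {x | fieldQ A X x ≠ 0} :=
  ((hA.contDiff_fieldQ X).contDiffOn.inv fun _ hx => hx).smul (hA.contDiff_fieldW X).contDiffOn

lemma IsEllipticCoefficient.isOpen_fieldQ_ne_zero (hA : IsEllipticCoefficient A) (X : ℝ) :
    IsOpen {x | fieldQ A X x ≠ 0} :=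
  isOpen_ne.preimage (hA.contDiff_fieldQ X).continuous

/-- The part of a ball in which the gradient of `ψ` is bounded below. -/
def goodRegion (d : ℕ) [NeZero d] (X R : ℝ) : Set (E d) :=
  Metric.closedBall 0 R ∩ {x | 3 / 4 ≤ ‖gradPsi X x‖ ^ 2}

lemma isCompact_goodRegion (X R : ℝ) : IsCompact (goodRegion d X R) :=
  (isCompact_closedBall _ _).inter_right
    (isClosed_le continuous_const ((contDiff_gradPsi (n := 0) X).continuous.norm.pow 2))

lemma closure_subset_goodRegion {X R : ℝ} (hX : 0 < X) {Ω : Set (E d)}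
    (h1 : Ω ⊆ Metric.ball 0 R) (h2 : Ω ⊆ paraboloidStrip d X) :
    closure Ω ⊆ goodRegion d X R :=
  closure_minimal (fun _ hx => ⟨Metric.ball_subset_closedBall (h1 hx), le_norm_gradPsi hX (h2 hx)⟩)
    (isCompact_goodRegion X R).isClosed

/-- All the constants that the pointwise inequality needs, on a compact set that depends only on
`X` and `R`. -/
lemma IsEllipticCoefficient.exists_bounds (hA : IsEllipticCoefficient A) (X α R : ℝ) :
    ∃ M K μ q : ℝ, 1 ≤ M ∧ 0 < K ∧ 0 < μ ∧ 0 < q ∧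
      (∀ x v : E d, μ * ‖v‖ ^ 2 ≤ inner ℝ (opA A x v) v) ∧
      ∀ x ∈ goodRegion d X R, psi X α x ≤ M ∧ q ≤ fieldQ A X x ∧ fieldQ A X x ≤ K ∧
        ‖fieldB A X x‖ ≤ K ∧ |divergence (fieldW A X) x| ≤ K ∧
        ∀ v : E d, |2 * inner ℝ (fderiv ℝ (fieldB A X) x (opA A x v)) v
          - inner ℝ (opA A x v) v * divergence (fieldB A X) x
          - inner ℝ (fderiv ℝ (opA A) x (fieldB A X x) v) v| ≤ K * ‖v‖ ^ 2 := by
  obtain ⟨μ, hμ, hell⟩ := hA.elliptic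
  have hK := isCompact_goodRegion (d := d) X R
  have hq : ∀ x ∈ goodRegion d X R, μ * (3 / 4) ≤ fieldQ A X x := fun x hx => by
    have h1 := hell x (gradPsi X x)
    rw [real_inner_comm] at h1
    exact (mul_le_mul_of_nonneg_left hx.2 hμ.le).trans h1
  have hsub : goodRegion d X R ⊆ {x | fieldQ A X x ≠ 0} := fun x hx =>
    ((by positivity : 0 < μ * (3 / 4)).trans_le (hq x hx)).ne'
  have hO := hA.isOpen_fieldQ_ne_zero X
  have hBC := hA.contDiffOn_fieldB X
  have cB : ContinuousOn (fieldB A X) (goodRegion d X R) := hBC.continuousOn.mono hsub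
  have cB' : ContinuousOn (fderiv ℝ (fieldB A X)) (goodRegion d X R) :=
    (hBC.continuousOn_fderiv_of_isOpen hO (by norm_num)).mono hsub
  have cdB : ContinuousOn (divergence (fieldB A X)) (goodRegion d X R) :=
    (continuousOn_divergence hO (hBC.of_le (by norm_num))).mono hsub
  have cdW : ContinuousOn (divergence (fieldW A X)) (goodRegion d X R) :=
    (continuousOn_divergence isOpen_univ
      (((hA.contDiff_fieldW X).of_le (by norm_num)).contDiffOn)).mono (subset_univ _)
  have cA : ContinuousOn (opA A) (goodRegion d X R) := hA.contDiff_opA.continuous.continuousOn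
  have cA'n : ContinuousOn (fun x => ‖fderiv ℝ (opA A) x‖) (goodRegion d X R) :=
    (hA.contDiff_opA.continuous_fderiv (by norm_num)).norm.continuousOn
  obtain ⟨M, hM⟩ := hK.exists_bound_of_continuousOn
    ((contDiff_psi (n := 0) X α).continuous.continuousOn (s := goodRegion d X R))
  obtain ⟨K₁, hK₁⟩ := hK.exists_bound_of_continuousOn
    ((hA.contDiff_fieldQ X).continuous.continuousOn (s := goodRegion d X R))
  obtain ⟨K₂, hK₂⟩ := hK.exists_bound_of_continuousOn cB
  obtain ⟨K₃, hK₃⟩ := hK.exists_bound_of_continuousOn cdW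
  obtain ⟨K₄, hK₄⟩ := hK.exists_bound_of_continuousOn
    (((((cB'.norm.const_mul 2).mul cA.norm).add (cA.norm.mul cdB.norm)).add (cA'n.mul cB.norm)))
  refine ⟨|M| + 1, |K₁| + |K₂| + |K₃| + |K₄| + 1, μ, μ * (3 / 4), by simp, by positivity, hμ,
    by positivity, hell, fun x hx => ⟨?_, hq x hx, ?_, ?_, ?_, fun v => ?_⟩⟩
  · have := (le_abs_self _).trans (hM x hx)
    linarith [le_abs_self M]
  · have := (le_abs_self _).trans (hK₁ x hx)
    linarith [le_abs_self K₁, abs_nonneg K₂, abs_nonneg K₃, abs_nonneg K₄]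
  · have := hK₂ x hx
    linarith [le_abs_self K₂, abs_nonneg K₁, abs_nonneg K₃, abs_nonneg K₄]
  · have : |divergence (fieldW A X) x| ≤ K₃ := hK₃ x hx
    linarith [le_abs_self K₃, abs_nonneg K₁, abs_nonneg K₂, abs_nonneg K₄]
  · have h0 := (le_abs_self _).trans (hK₄ x hx)
    simp only [Pi.add_apply, Pi.mul_apply] at h0
    have i0 : ‖opA A x v‖ ≤ ‖opA A x‖ * ‖v‖ := (opA A x).le_opNorm v
    have i1 : |inner ℝ (fderiv ℝ (fieldB A X) x (opA A x v)) v|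
        ≤ ‖fderiv ℝ (fieldB A X) x‖ * (‖opA A x‖ * ‖v‖) * ‖v‖ :=
      (abs_real_inner_le_norm _ _).trans (by
        gcongr; exact ((fderiv ℝ (fieldB A X) x).le_opNorm _).trans (by gcongr))
    have i2 : |inner ℝ (opA A x v) v * divergence (fieldB A X) x|
        ≤ ‖opA A x‖ * ‖v‖ * ‖v‖ * ‖divergence (fieldB A X) x‖ := by
      rw [abs_mul]
      exact mul_le_mul_of_nonneg_right ((abs_real_inner_le_norm _ _).trans (by gcongr))
        (abs_nonneg _)
    have i3 : |inner ℝ (fderiv ℝ (opA A) x (fieldB A X x) v) v|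
        ≤ ‖fderiv ℝ (opA A) x‖ * ‖fieldB A X x‖ * ‖v‖ * ‖v‖ :=
      (abs_real_inner_le_norm _ _).trans (by
        gcongr
        exact (ContinuousLinearMap.le_opNorm _ _).trans (by
          gcongr; exact (fderiv ℝ (opA A) x).le_opNorm _))
    calc _ ≤ 2 * |inner ℝ (fderiv ℝ (fieldB A X) x (opA A x v)) v|
          + |inner ℝ (opA A x v) v * divergence (fieldB A X) x|
          + |inner ℝ (fderiv ℝ (opA A) x (fieldB A X x) v) v| := by
          refine (abs_sub _ _).trans (add_le_add_left ((abs_sub _ _).trans ?_) _)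
          rw [abs_mul, abs_two]
      _ ≤ K₄ * ‖v‖ ^ 2 := by
          have := mul_le_mul_of_nonneg_right h0 (sq_nonneg ‖v‖)
          nlinarith
      _ ≤ _ := by
          gcongr
          linarith [le_abs_self K₄, abs_nonneg K₁, abs_nonneg K₂, abs_nonneg K₃]

end Coefficients

/-! ### Regularity and boundary behaviour of the field -/

section Regularity

lemma contDiffOn_zeta {n : WithTop ℕ∞} (l p : ℝ) : ContDiffOn ℝ n (zeta l p) (Ioi 0) :=
  contDiffOn_const.mul (contDiffOn_id.rpow_const_of_ne fun _ hx => (ne_of_gt hx))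

lemma contDiffOn_exp_zeta {n : WithTop ℕ∞} (l p : ℝ) :
    ContDiffOn ℝ n (fun y => Real.exp (2 * zeta l p y)) (Ioi 0) :=
  (contDiffOn_const.mul (contDiffOn_zeta l p)).exp

lemma contDiffOn_coefG {n : WithTop ℕ∞} (l p : ℝ) : ContDiffOn ℝ n (coefG l p) (Ioi 0) :=
  ((contDiffOn_const.mul contDiffOn_id).mul (contDiffOn_exp_zeta l p)).neg

lemma contDiffOn_coefC {n : WithTop ℕ∞} (l p : ℝ) : ContDiffOn ℝ n (coefC l p) (Ioi 0) :=
  ((contDiffOn_const.mul (contDiffOn_zeta l p)).mul (contDiffOn_exp_zeta l p)).add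
    (contDiffOn_const.mul ((contDiffOn_const.sub (contDiffOn_const.mul (contDiffOn_zeta l p))).add
      ((contDiffOn_exp_zeta l p).div_const 4)))

lemma contDiffOn_coefB {n : WithTop ℕ∞} (l p : ℝ) : ContDiffOn ℝ n (coefB l p) (Ioi 0) :=
  (contDiffOn_const.div contDiffOn_id fun _ hx => (ne_of_gt hx)).mul
    ((((contDiffOn_const.mul (contDiffOn_zeta l p)).sub
      (contDiffOn_const.mul ((contDiffOn_zeta l p).pow 2))).mul (contDiffOn_exp_zeta l p)).sub
      (contDiffOn_const.mul (contDiffOn_zeta l p)))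

variable {d : ℕ} {u : E d → ℝ} {G : E d → E d} {𝒜 : E d → E d →L[ℝ] E d} {B w : E d → E d}
  {ψ : E d → ℝ} {g c b : ℝ → ℝ} {s : Set (E d)}

lemma contDiffOn_carlemanField (hu : ContDiffOn ℝ 1 u s) (hG : ContDiffOn ℝ 1 G s)
    (h𝒜 : ContDiffOn ℝ 1 𝒜 s) (hB : ContDiffOn ℝ 1 B s) (hw : ContDiffOn ℝ 1 w s)
    (hg : ContDiffOn ℝ 1 (fun x => g (ψ x)) s) (hc : ContDiffOn ℝ 1 (fun x => c (ψ x)) s)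
    (hb : ContDiffOn ℝ 1 (fun x => b (ψ x)) s) :
    ContDiffOn ℝ 1 (carlemanField u G 𝒜 B w ψ g c b) s := by
  have hW : ContDiffOn ℝ 1 (fun x => 𝒜 x (G x)) s := h𝒜.clm_apply hG
  exact (((((contDiffOn_const.mul hg).mul (hB.inner ℝ hG)).add (hc.mul hu)).smul hW).add
    (((hg.mul (hW.inner ℝ hG)).neg).smul hB)).add ((hb.mul (hu.pow 2)).smul hw)

/-- The field is quadratic in `(u, ∇u)`, so it vanishes to second order where both vanish. -/
lemma isBigO_carlemanField {x : E d} (hx : x ∈ s) (hu : DifferentiableWithinAt ℝ u s x)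
    (hG : DifferentiableWithinAt ℝ G s x) (hu0 : u x = 0) (hG0 : G x = 0)
    (h𝒜 : ContinuousOn 𝒜 s) (hB : ContinuousOn B s) (hw : ContinuousOn w s)
    (hg : ContinuousOn (fun x => g (ψ x)) s) (hc : ContinuousOn (fun x => c (ψ x)) s)
    (hb : ContinuousOn (fun x => b (ψ x)) s) :
    carlemanField u G 𝒜 B w ψ g c b =O[𝓝[s] x] fun y => ‖y - x‖ ^ 2 := by
  have ou : u =O[𝓝[s] x] fun y => ‖y - x‖ := by simpa [hu0] using hu.isBigO_sub.norm_right
  have oG : G =O[𝓝[s] x] fun y => ‖y - x‖ := by simpa [hG0] using hG.isBigO_sub.norm_right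
  have o𝒜 := (h𝒜 x hx).isBigO_one ℝ
  have oB := (hB x hx).isBigO_one ℝ
  have ow := (hw x hx).isBigO_one ℝ
  have og := (hg x hx).isBigO_one ℝ
  have oc := (hc x hx).isBigO_one ℝ
  have ob := (hb x hx).isBigO_one ℝ
  have inn : ∀ {V₁ V₂ : E d → E d} {r₁ r₂ : E d → ℝ}, V₁ =O[𝓝[s] x] r₁ → V₂ =O[𝓝[s] x] r₂ →
      (fun y => inner ℝ (V₁ y) (V₂ y)) =O[𝓝[s] x] fun y => r₁ y * r₂ y := fun h₁ h₂ =>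
    (isBoundedBilinearMap_inner.isBigO_comp (𝕜 := ℝ)).trans (h₁.norm_left.mul h₂.norm_left)
  have oW : (fun y => 𝒜 y (G y)) =O[𝓝[s] x] fun y => ‖y - x‖ := by
    refine ((isBoundedBilinearMap_apply (𝕜 := ℝ) (E := E d) (F := E d)).isBigO_comp
      (g := 𝒜) (h := G)).trans ?_
    simpa using o𝒜.norm_left.mul oG.norm_left
  have t1 := (((og.const_mul_left 2).mul (inn oB oG)).add
    ((oc.mul ou).congr_right (fun y => by simp :
      ∀ y, (1 : ℝ) * ‖y - x‖ = 1 * (1 * ‖y - x‖)))).smul oW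
  have t2 := ((og.mul (inn oW oG)).neg_left).smul oB
  have t3 := (ob.mul (ou.pow 2)).smul ow
  have t1' := t1.congr_right (g₂ := fun y => ‖y - x‖ ^ 2) fun y => by simp [pow_two]
  have t2' := t2.congr_right (g₂ := fun y => ‖y - x‖ ^ 2) fun y => by simp [pow_two]
  have t3' := t3.congr_right (g₂ := fun y => ‖y - x‖ ^ 2) fun y => by simp
  exact (t1'.add t2').add t3'

lemma contDiffOn_gradientWithin (hs : UniqueDiffOn ℝ s) (hu : ContDiffOn ℝ 2 u s) :
    ContDiffOn ℝ 1 (gradientWithin u s) s :=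
  (InnerProductSpace.toDual ℝ (E d)).symm.contDiff.comp_contDiffOn
    (hu.fderivWithin hs (m := 1) (by norm_num))

variable {Ω : Set (E d)} {x : E d}

lemma gradientWithin_closure_eq (hΩ : IsOpen Ω) (hx : x ∈ Ω) :
    gradientWithin u (closure Ω) x = gradient u x := by
  rw [gradientWithin, gradient,
    fderivWithin_of_mem_nhds (mem_of_superset (hΩ.mem_nhds hx) subset_closure)]

lemma divAGrad_eq {A : E d → Matrix (Fin d) (Fin d) ℝ} (hΩ : IsOpen Ω) (hx : x ∈ Ω) :
    divAGrad A u x = divergence (fun y => opA A y (gradientWithin u (closure Ω) y)) x := by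
  simp only [divAGrad, divergence]
  refine Finset.sum_congr rfl fun i _ => ?_
  have : (fun y => mulVecE (A y) (gradient u y) i)
      =ᶠ[𝓝 x] fun y => opA A y (gradientWithin u (closure Ω) y) i := by
    filter_upwards [hΩ.mem_nhds hx] with y hy
    rw [gradientWithin_closure_eq hΩ hy, opA_apply]
  rw [this.fderiv_eq]

lemma hasFDerivAt_innerSL_gradientWithin (hΩ : IsOpen Ω) (hu : ContDiffOn ℝ 2 u (closure Ω))
    (hx : x ∈ Ω) : HasFDerivAt u (innerSL ℝ (gradientWithin u (closure Ω) x)) x := by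
  have hd : DifferentiableAt ℝ u x := ((hu x (subset_closure hx)).contDiffAt
    (mem_of_superset (hΩ.mem_nhds hx) subset_closure)).differentiableAt (by norm_num)
  rw [gradientWithin_closure_eq hΩ hx]
  exact hd.hasGradientAt.hasFDerivAt

/-- Symmetry of the Hessian. -/
lemma inner_fderiv_gradientWithin (hΩ : IsOpen Ω) (hs : UniqueDiffOn ℝ (closure Ω))
    (hu : ContDiffOn ℝ 2 u (closure Ω)) (hx : x ∈ Ω) (h k : E d) :
    inner ℝ (fderiv ℝ (gradientWithin u (closure Ω)) x h) k
      = inner ℝ (fderiv ℝ (gradientWithin u (closure Ω)) x k) h := by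
  have hG : DifferentiableAt ℝ (gradientWithin u (closure Ω)) x :=
    ((contDiffOn_gradientWithin hs hu x (subset_closure hx)).contDiffAt
      (mem_of_superset (hΩ.mem_nhds hx) subset_closure)).differentiableAt (by norm_num)
  have h2 := (ContinuousLinearMap.hasFDerivAt (innerSL ℝ : E d →L[ℝ] E d →L[ℝ] ℝ)
    (x := gradientWithin u (closure Ω) x)).comp x
    hG.hasFDerivAt
  have h1 : ∀ᶠ y in 𝓝 x, HasFDerivAt u (innerSL ℝ (gradientWithin u (closure Ω) y)) y := by
    filter_upwards [hΩ.mem_nhds hx] with y hy using hasFDerivAt_innerSL_gradientWithin hΩ hu hy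
  exact second_derivative_symmetric_of_eventually h1 h2 h k

end Regularity

/-! ### The integrated inequality -/

section Integrated

variable {d : ℕ} [NeZero d] {A : E d → Matrix (Fin d) (Fin d) ℝ} {X α R M K μ q l p : ℝ}
  {Ω : Set (E d)} {u : E d → ℝ}

/-- The field whose divergence gives the Carleman estimate for `u`. It uses the gradient along
`closure Ω`, so that it is of class `C¹` up to the boundary. -/
noncomputable def cauchyField (A : E d → Matrix (Fin d) (Fin d) ℝ) (X α l p : ℝ) (Ω : Set (E d))
    (u : E d → ℝ) : E d → E d :=
  carlemanField u (gradientWithin u (closure Ω)) (opA A) (fieldB A X) (fieldW A X) (psi X α)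
    (coefG l p) (coefC l p) (coefB l p)

lemma zeta_mul_div {y : ℝ} (hy : 0 < y) :
    l * (zeta l p y ^ 2 / y ^ 2) = l ^ 3 * y ^ (-2 * p - 2) := by
  have h1 : y ^ (-2 * p - 2) = y ^ (-p) * y ^ (-p) / y ^ 2 := by
    rw [← Real.rpow_add hy, ← Real.rpow_natCast, ← Real.rpow_sub hy]
    congr 1; push_cast; ring
  rw [zeta, h1]; ring

lemma mul_div_zeta {y : ℝ} (hl : 0 < l) (hy : 0 < y) : l * (y ^ 2 / zeta l p y) = y ^ (p + 2) := by
  have h1 : y ^ (p + 2) = y ^ 2 / y ^ (-p) := by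
    rw [← Real.rpow_natCast, ← Real.rpow_sub hy]
    congr 1; push_cast; ring
  have := Real.rpow_pos_of_pos hy (-p)
  rw [zeta, h1]; field_simp

lemma weight_eq (x : E d) : weight X α l p x = Real.exp (2 * zeta l p (psi X α x)) := by
  rw [weight, zeta, mul_assoc]

/-- The pointwise inequality, with the constants of `IsEllipticCoefficient.exists_bounds`. -/
lemma pointwise_carleman (hA : IsEllipticCoefficient A) (hΩ : IsOpen Ω)
    (hs : UniqueDiffOn ℝ (closure Ω)) (hu : ContDiffOn ℝ 2 u (closure Ω))
    (hK : 0 < K) (hμ : 0 < μ) (hq : 0 < q)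
    (hell : ∀ x v : E d, μ * ‖v‖ ^ 2 ≤ inner ℝ (opA A x v) v) {x : E d} (hx : x ∈ Ω)
    (hψ : 0 < psi X α x) (hM : psi X α x ≤ M) (hqQ : q ≤ fieldQ A X x) (hQK : fieldQ A X x ≤ K)
    (hB : ‖fieldB A X x‖ ≤ K) (hD : |divergence (fieldW A X) x| ≤ K)
    (hE : ∀ v : E d, |2 * inner ℝ (fderiv ℝ (fieldB A X) x (opA A x v)) v
          - inner ℝ (opA A x v) v * divergence (fieldB A X) x
          - inner ℝ (fderiv ℝ (opA A) x (fieldB A X x) v) v| ≤ K * ‖v‖ ^ 2)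
    (hl : 0 < l) (hp : 1 ≤ p) (hp1 : 16 * (2 * K ^ 3 + M * K) / μ ≤ p)
    (hp2 : 16 * (7 * K * (1 + M)) / q ≤ p) :
    l * p ^ 2 * (μ / 16) * (weight X α l p x * ‖gradient u x‖ ^ 2)
      + l ^ 3 * p ^ 4 * (q / 8) * (psi X α x ^ (-2 * p - 2) * weight X α l p x * |u x| ^ 2)
    ≤ 50000 / q * (psi X α x ^ (p + 2) * weight X α l p x * |divAGrad A u x| ^ 2)
      + l * divergence (cauchyField A X α l p Ω u) x := by
  have hQ : fieldQ A X x ≠ 0 := (hq.trans_le hqQ).ne'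
  have hn : closure Ω ∈ 𝓝 x := mem_of_superset (hΩ.mem_nhds hx) subset_closure
  have hG : DifferentiableAt ℝ (gradientWithin u (closure Ω)) x :=
    ((contDiffOn_gradientWithin hs hu x (subset_closure hx)).contDiffAt hn).differentiableAt
      (by norm_num)
  have hBd : DifferentiableAt ℝ (fieldB A X) x :=
    ((hA.contDiffOn_fieldB X).contDiffAt
      ((hA.isOpen_fieldQ_ne_zero X).mem_nhds hQ)).differentiableAt (by norm_num)
  have hWd : DifferentiableAt ℝ (fieldW A X) x :=
    (hA.contDiff_fieldW X).differentiable (by norm_num) x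
  have hAd : DifferentiableAt ℝ (opA A) x := hA.contDiff_opA.differentiable (by norm_num) x
  have key := divergence_carlemanField (Q := fieldQ A X x)
    (hasFDerivAt_innerSL_gradientWithin hΩ hu hx) hG.hasFDerivAt
    (inner_fderiv_gradientWithin hΩ hs hu hx) hAd.hasFDerivAt (hA.inner_opA x) hBd.hasFDerivAt
    hWd.hasFDerivAt (hasFDerivAt_psi X α x)
    (by
      rw [innerSL_apply_apply, fieldB, inner_smul_right]
      exact inv_mul_cancel₀ hQ)
    (fun h => by rw [innerSL_apply_apply, fieldW, hA.inner_opA])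
    rfl (by rw [fieldB, smul_inv_smul₀ hQ])
    (hasDerivAt_coefG (l := l) (p := p) hψ) (hasDerivAt_coefC (l := l) (p := p) hψ)
    (hasDerivAt_coefB (l := l) (p := p) hψ)
  rw [← divAGrad_eq hΩ hx] at key
  have hpt := pointwise_le (L := divAGrad A u x) (u := u x)
    (N := ‖gradientWithin u (closure Ω) x‖)
    (s := inner ℝ (fieldB A X x) (gradientWithin u (closure Ω) x))
    hK hμ hq hl hp hψ hM hp1 hp2 hqQ hQK
    ((abs_real_inner_le_norm _ _).trans (by gcongr)) (hell x _) (hE _) hD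
  have hdiv : divergence (cauchyField A X α l p Ω u) x = _ := key
  rw [← hdiv, gradientWithin_closure_eq hΩ hx] at hpt
  have h := mul_le_mul_of_nonneg_left hpt hl.le
  rw [weight_eq, sq_abs, sq_abs, ← mul_div_zeta hl hψ]
  have e1 := zeta_mul_div (l := l) (p := p) hψ
  calc _ = l * p ^ 2 * (μ / 16) * (Real.exp (2 * zeta l p (psi X α x)) * ‖gradient u x‖ ^ 2)
        + (l ^ 3 * psi X α x ^ (-2 * p - 2)) * (p ^ 4 * (q / 8)
          * (Real.exp (2 * zeta l p (psi X α x)) * u x ^ 2)) := by ring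
    _ = l * (p ^ 2 * Real.exp (2 * zeta l p (psi X α x)) * (μ / 16) * ‖gradient u x‖ ^ 2
        + p ^ 4 / psi X α x ^ 2 * (q / 8) * Real.exp (2 * zeta l p (psi X α x))
          * zeta l p (psi X α x) ^ 2 * u x ^ 2) := by rw [← e1]; ring
    _ ≤ _ := h
    _ = _ := by ring

lemma continuousOn_psi_rpow {s : Set (E d)} (hψ : ∀ x ∈ s, 0 < psi X α x) (r : ℝ) :
    ContinuousOn (fun x => psi X α x ^ r) s :=
  (contDiff_psi (n := 0) X α).continuous.continuousOn.rpow_const fun x hx => Or.inl (hψ x hx).ne'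

lemma continuousOn_weight {s : Set (E d)} (hψ : ∀ x ∈ s, 0 < psi X α x) :
    ContinuousOn (weight X α l p) s :=
  Real.continuous_exp.comp_continuousOn (continuousOn_const.mul (continuousOn_psi_rpow hψ _))

lemma IsEllipticCoefficient.contDiffOn_cauchyField (hA : IsEllipticCoefficient A)
    (hs : UniqueDiffOn ℝ (closure Ω)) (hu : ContDiffOn ℝ 2 u (closure Ω))
    (hψ : ∀ x ∈ closure Ω, 0 < psi X α x) (hQ : ∀ x ∈ closure Ω, fieldQ A X x ≠ 0) :
    ContDiffOn ℝ 1 (cauchyField A X α l p Ω u) (closure Ω) :=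
  contDiffOn_carlemanField (hu.of_le (by norm_num)) (contDiffOn_gradientWithin hs hu)
    (hA.contDiff_opA.of_le (by norm_num)).contDiffOn
    (((hA.contDiffOn_fieldB X).mono hQ).of_le (by norm_num))
    ((hA.contDiff_fieldW X).of_le (by norm_num)).contDiffOn
    ((contDiffOn_coefG l p).comp (contDiff_psi X α).contDiffOn hψ)
    ((contDiffOn_coefC l p).comp (contDiff_psi X α).contDiffOn hψ)
    ((contDiffOn_coefB l p).comp (contDiff_psi X α).contDiffOn hψ)

lemma IsEllipticCoefficient.isBigO_cauchyField (hA : IsEllipticCoefficient A)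
    (hΩ : IsOpen Ω) (hS : HasSmoothBoundary Ω) (hu : IsC2WithZeroCauchyData A Ω u)
    (hψ : ∀ x ∈ closure Ω, 0 < psi X α x) (hQ : ∀ x ∈ closure Ω, fieldQ A X x ≠ 0)
    {x : E d} (hx : x ∈ frontier Ω) :
    cauchyField A X α l p Ω u =O[𝓝[Ω] x] fun y => ‖y - x‖ ^ 2 := by
  have hs := hS.uniqueDiffOn_closure hΩ
  refine IsBigO.mono ?_ (nhdsWithin_mono x subset_closure)
  exact isBigO_carlemanField hx.1 ((hu.contDiffOn x hx.1).differentiableWithinAt (by norm_num))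
    ((contDiffOn_gradientWithin hs hu.contDiffOn x hx.1).differentiableWithinAt (by norm_num))
    (hu.dirichlet x hx) (hu.gradientWithin_eq_zero hA hS hx)
    hA.contDiff_opA.continuous.continuousOn
    ((hA.contDiffOn_fieldB X).continuousOn.mono hQ)
    (hA.contDiff_fieldW X).continuous.continuousOn
    ((contDiffOn_coefG (n := 0) l p).comp (contDiff_psi X α).contDiffOn hψ).continuousOn
    ((contDiffOn_coefC (n := 0) l p).comp (contDiff_psi X α).contDiffOn hψ).continuousOn
    ((contDiffOn_coefB (n := 0) l p).comp (contDiff_psi X α).contDiffOn hψ).continuousOn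

lemma integrableOn_weight_mul_gradient (hΩ : IsOpen Ω) (hb : Bornology.IsBounded Ω)
    (hs : UniqueDiffOn ℝ (closure Ω)) (hu : ContDiffOn ℝ 2 u (closure Ω))
    (hψ : ∀ x ∈ closure Ω, 0 < psi X α x) :
    IntegrableOn (fun x => weight X α l p x * ‖gradient u x‖ ^ 2) Ω := by
  refine (ContinuousOn.integrableOn_of_isBounded hb
    ((continuousOn_weight (l := l) (p := p) hψ).mul
    ((contDiffOn_gradientWithin hs hu).continuousOn.norm.pow 2))).congr_fun (fun x hx => ?_)
    hΩ.measurableSet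
  simp only [Pi.mul_apply, Pi.pow_apply, gradientWithin_closure_eq hΩ hx]

lemma integrableOn_psi_mul_weight_mul_sq (hb : Bornology.IsBounded Ω)
    (hu : ContinuousOn u (closure Ω)) (hψ : ∀ x ∈ closure Ω, 0 < psi X α x) (r : ℝ) :
    IntegrableOn (fun x => psi X α x ^ r * weight X α l p x * |u x| ^ 2) Ω :=
  ContinuousOn.integrableOn_of_isBounded hb
    (((continuousOn_psi_rpow hψ r).mul (continuousOn_weight hψ)).mul (hu.abs.pow 2))

lemma integrableOn_psi_mul_weight_mul_divAGrad (hA : IsEllipticCoefficient A) (hΩ : IsOpen Ω)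
    (hb : Bornology.IsBounded Ω) (hs : UniqueDiffOn ℝ (closure Ω))
    (hu : ContDiffOn ℝ 2 u (closure Ω)) (hψ : ∀ x ∈ closure Ω, 0 < psi X α x) (r : ℝ) :
    IntegrableOn (fun x => psi X α x ^ r * weight X α l p x * |divAGrad A u x| ^ 2) Ω := by
  have hW : ContDiffOn ℝ 1 (fun y => opA A y (gradientWithin u (closure Ω) y)) (closure Ω) :=
    (hA.contDiff_opA.of_le (by norm_num)).contDiffOn.clm_apply (contDiffOn_gradientWithin hs hu)
  refine (ContinuousOn.integrableOn_of_isBounded hb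
    (((continuousOn_psi_rpow hψ r).mul (continuousOn_weight (l := l) (p := p) hψ)).mul
      ((continuousOn_divergenceWithin hs hW).abs.pow 2))).congr_fun (fun x hx => ?_)
    hΩ.measurableSet
  simp only [Pi.mul_apply, Pi.pow_apply, divAGrad_eq hΩ hx, divergenceWithin_eq hΩ hW hx]

/-- The Carleman estimate with constants that do not depend on `Ω`, and for all `λ > 0`. The gradient
term carries the factor `p²`, which is stronger than `p`. -/
theorem IsEllipticCoefficient.exists_carleman (hA : IsEllipticCoefficient A) (hX : 0 < X)
    (α R : ℝ) :
    ∃ M σ C : ℝ, 1 ≤ M ∧ 1 ≤ σ ∧ 0 < C ∧ ∀ Ω : Set (E d), IsOpen Ω → HasSmoothBoundary Ω →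
      Ω ⊆ Metric.ball 0 R → Ω ⊆ paraboloidStrip d X → (∀ x ∈ closure Ω, 0 < psi X α x) →
      (∀ x ∈ Ω, psi X α x ≤ M) ∧
      ∀ l p : ℝ, 0 < l → σ < p → ∀ u : E d → ℝ, IsC2WithZeroCauchyData A Ω u →
        l * p ^ 2 * (∫ x in Ω, weight X α l p x * ‖gradient u x‖ ^ 2)
          + l ^ 3 * p ^ 4 * (∫ x in Ω, psi X α x ^ (-2 * p - 2) * weight X α l p x * |u x| ^ 2)
        ≤ C * (∫ x in Ω, psi X α x ^ (p + 2) * weight X α l p x * |divAGrad A u x| ^ 2) := by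
  obtain ⟨M, K, μ, q, hM1, hK, hμ, hq, hell, hbd⟩ := hA.exists_bounds X α R
  refine ⟨M, max 1 (max (16 * (2 * K ^ 3 + M * K) / μ) (16 * (7 * K * (1 + M)) / q)),
    (16 / μ + 8 / q) * (50000 / q), hM1, le_max_left _ _, by positivity,
    fun Ω hΩ hS hR hP hψ => ?_⟩
  have hreg := closure_subset_goodRegion hX hR hP
  have hs := hS.uniqueDiffOn_closure hΩ
  have hb : Bornology.IsBounded Ω := Metric.isBounded_ball.subset hR
  have hQ : ∀ x ∈ closure Ω, fieldQ A X x ≠ 0 := fun x hx =>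
    (hq.trans_le (hbd x (hreg hx)).2.1).ne'
  refine ⟨fun x hx => (hbd x (hreg (subset_closure hx))).1, fun l p hl hp u hu => ?_⟩
  obtain ⟨hp0, hp1, hp2⟩ : 1 < p ∧ 16 * (2 * K ^ 3 + M * K) / μ < p
      ∧ 16 * (7 * K * (1 + M)) / q < p := by simpa [max_lt_iff] using hp
  have hF := hA.contDiffOn_cauchyField (l := l) (p := p) hs hu.contDiffOn hψ hQ
  have hzero := integral_divergence_eq_zero hΩ hb hs hF
    fun x hx => hA.isBigO_cauchyField hΩ hS hu hψ hQ hx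
  have iF := integrableOn_divergence hΩ hb hs hF
  have i1 := integrableOn_weight_mul_gradient (l := l) (p := p) hΩ hb hs hu.contDiffOn hψ
  have i2 := integrableOn_psi_mul_weight_mul_sq (l := l) (p := p) hb hu.contDiffOn.continuousOn hψ
    (-2 * p - 2)
  have i3 := integrableOn_psi_mul_weight_mul_divAGrad (l := l) (p := p) hA hΩ hb hs hu.contDiffOn
    hψ (p + 2)
  have hint := setIntegral_mono_on
    ((i1.const_mul (l * p ^ 2 * (μ / 16))).add (i2.const_mul (l ^ 3 * p ^ 4 * (q / 8))))
    ((i3.const_mul (50000 / q)).add (iF.const_mul l)) hΩ.measurableSet fun x hx => by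
      have hx' := subset_closure hx
      obtain ⟨b1, b2, b3, b4, b5, b6⟩ := hbd x (hreg hx')
      exact pointwise_carleman (α := α) hA hΩ hs hu.contDiffOn hK hμ hq hell hx (hψ x hx') b1 b2 b3
        b4 b5 b6 hl hp0.le hp1.le hp2.le
  simp only [Pi.add_apply] at hint
  rw [integral_add (i1.const_mul _) (i2.const_mul _), integral_add (i3.const_mul _)
    (iF.const_mul _), integral_const_mul, integral_const_mul, integral_const_mul,
    integral_const_mul, hzero, mul_zero, add_zero] at hint
  set I₁ := ∫ x in Ω, weight X α l p x * ‖gradient u x‖ ^ 2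
  set I₂ := ∫ x in Ω, psi X α x ^ (-2 * p - 2) * weight X α l p x * |u x| ^ 2
  set J := ∫ x in Ω, psi X α x ^ (p + 2) * weight X α l p x * |divAGrad A u x| ^ 2
  have h1 : 0 ≤ I₁ := integral_nonneg fun x => mul_nonneg (Real.exp_pos _).le (sq_nonneg _)
  have h2 : 0 ≤ I₂ := setIntegral_nonneg hΩ.measurableSet fun x hx =>
    mul_nonneg (mul_nonneg (Real.rpow_nonneg (hψ x (subset_closure hx)).le _)
      (Real.exp_pos _).le) (sq_nonneg _)
  have h3 : 0 ≤ l * p ^ 2 * I₁ * (μ / q / 2) + l ^ 3 * p ^ 4 * I₂ * (2 * q / μ) := by positivity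
  calc l * p ^ 2 * I₁ + l ^ 3 * p ^ 4 * I₂
      ≤ l * p ^ 2 * I₁ + l ^ 3 * p ^ 4 * I₂
        + (l * p ^ 2 * I₁ * (μ / q / 2) + l ^ 3 * p ^ 4 * I₂ * (2 * q / μ)) := by linarith
    _ = (16 / μ + 8 / q) * (l * p ^ 2 * (μ / 16) * I₁ + l ^ 3 * p ^ 4 * (q / 8) * I₂) := by
        field_simp; ring
    _ ≤ (16 / μ + 8 / q) * (50000 / q * J) := by gcongr
    _ = _ := by ring

end Integrated

end Carleman

theorem mainTheorem2 (d : ℕ) [NeZero d] (hd : 2 ≤ d)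
    (A : Carleman.E d → Matrix (Fin d) (Fin d) ℝ) (hA : Carleman.IsEllipticCoefficient A)
    (X : ℝ) (hX0 : 0 < X) (hX1 : X < 1) (α : ℝ) (hα0 : 0 < α) (hα1 : α < 1 / 2) (R : ℝ) :
    ∃ σ₀ σ₁ : ℝ, 0 < σ₀ ∧ 0 < σ₁ ∧
      ∀ Ω : Set (Carleman.E d), IsOpen Ω → Carleman.HasSmoothBoundary Ω →
        Ω ⊆ Metric.ball 0 R → Ω ⊆ Carleman.paraboloidStrip d X →
        (∀ x ∈ closure Ω, 0 < Carleman.psi X α x) →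
        (∃ C : ℝ, 0 < C ∧ ∀ l p : ℝ, σ₀ < l → σ₁ < p →
          ∀ u : Carleman.E d → ℝ, Carleman.IsC2WithZeroCauchyData A Ω u →
            (l * p / X ^ 2) * (∫ x in Ω, Carleman.weight X α l p x * ‖gradient u x‖ ^ 2)
              + (l ^ 3 * p ^ 4) * (∫ x in Ω,
                  (Carleman.psi X α x) ^ (-2 * p - 2) * Carleman.weight X α l p x * |u x| ^ 2)
            ≤ C * (∫ x in Ω, (Carleman.psi X α x) ^ (p + 2) * Carleman.weight X α l p x
                  * |Carleman.divAGrad A u x| ^ 2)) ∧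
        (∀ p : ℝ, σ₁ < p → ∃ C : ℝ, 0 < C ∧ ∀ l : ℝ, σ₀ < l →
          ∀ u : Carleman.E d → ℝ, Carleman.IsC2WithZeroCauchyData A Ω u →
            (l * p) * (∫ x in Ω, Carleman.weight X α l p x * ‖gradient u x‖ ^ 2)
              + (l ^ 3 * p ^ 4) * (∫ x in Ω, Carleman.weight X α l p x * |u x| ^ 2)
            ≤ C * (∫ x in Ω, Carleman.weight X α l p x
                  * |Carleman.divAGrad A u x| ^ 2)) := by
  obtain ⟨M, σ, C, hM, hσ, hC, hmain⟩ := hA.exists_carleman hX0 α R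
  refine ⟨1, σ, one_pos, one_pos.trans_le hσ, fun Ω hΩ hS hR hP hψ => ?_⟩
  obtain ⟨hψM, hest⟩ := hmain Ω hΩ hS hR hP hψ
  have hs := hS.uniqueDiffOn_closure hΩ
  have hb : Bornology.IsBounded Ω := Metric.isBounded_ball.subset hR
  have hpos : ∀ x ∈ Ω, 0 < Carleman.psi X α x := fun x hx => hψ x (subset_closure hx)
  refine ⟨⟨(1 / X ^ 2 + 1) * C, by positivity, fun l p hl hp u hu => ?_⟩, fun p hp =>
    ⟨M ^ (2 * p + 2) * C * M ^ (p + 2), by positivity, fun l hl u hu => ?_⟩⟩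
  · have hl0 : 0 < l := one_pos.trans hl
    have hp1 : 1 < p := hσ.trans_lt hp
    have h := hest l p hl0 hp u hu
    set I₁ := ∫ x in Ω, Carleman.weight X α l p x * ‖gradient u x‖ ^ 2
    set I₂ := ∫ x in Ω,
      Carleman.psi X α x ^ (-2 * p - 2) * Carleman.weight X α l p x * |u x| ^ 2
    have h1 : 0 ≤ I₁ :=
      integral_nonneg fun x => mul_nonneg (Real.exp_pos _).le (sq_nonneg _)
    have h2 : 0 ≤ I₂ := setIntegral_nonneg hΩ.measurableSet fun x hx =>
      mul_nonneg (mul_nonneg (Real.rpow_nonneg (hpos x hx).le _) (Real.exp_pos _).le) (sq_nonneg _)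
    have h3 : 0 ≤ l * p ^ 2 * I₁ + 1 / X ^ 2 * (l ^ 3 * p ^ 4 * I₂) := by positivity
    calc l * p / X ^ 2 * I₁ + l ^ 3 * p ^ 4 * I₂
        = 1 / X ^ 2 * (l * p * 1 * I₁) + l ^ 3 * p ^ 4 * I₂ := by ring
      _ ≤ 1 / X ^ 2 * (l * p * p * I₁) + l ^ 3 * p ^ 4 * I₂ := by gcongr
      _ ≤ (1 / X ^ 2 + 1) * (l * p ^ 2 * I₁ + l ^ 3 * p ^ 4 * I₂) := by linarith
      _ ≤ (1 / X ^ 2 + 1) * (C * _) := mul_le_mul_of_nonneg_left h (by positivity)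
      _ = _ := by ring
  · have hl0 : 0 < l := one_pos.trans hl
    have hp1 : 1 < p := hσ.trans_lt hp
    have h := hest l p hl0 hp u hu
    have i0 := Carleman.integrableOn_psi_mul_weight_mul_sq (l := l) (p := p) hb
      hu.contDiffOn.continuousOn hψ 0
    have i2 := Carleman.integrableOn_psi_mul_weight_mul_sq (l := l) (p := p) hb
      hu.contDiffOn.continuousOn hψ (-2 * p - 2)
    have j0 := Carleman.integrableOn_psi_mul_weight_mul_divAGrad (l := l) (p := p) hA hΩ hb hs
      hu.contDiffOn hψ 0
    have j1 := Carleman.integrableOn_psi_mul_weight_mul_divAGrad (l := l) (p := p) hA hΩ hb hs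
      hu.contDiffOn hψ (p + 2)
    simp only [Real.rpow_zero, one_mul] at i0 j0
    have hu2 : (∫ x in Ω, Carleman.weight X α l p x * |u x| ^ 2) ≤ M ^ (2 * p + 2) * ∫ x in Ω,
        Carleman.psi X α x ^ (-2 * p - 2) * Carleman.weight X α l p x * |u x| ^ 2 := by
      rw [← integral_const_mul]
      refine setIntegral_mono_on i0 (i2.const_mul _) hΩ.measurableSet fun x hx => ?_
      have hx0 := hpos x hx
      have h1 : 1 ≤ M ^ (2 * p + 2) * Carleman.psi X α x ^ (-2 * p - 2) := by
        rw [show -2 * p - 2 = -(2 * p + 2) by ring, Real.rpow_neg hx0.le, ← div_eq_mul_inv,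
          one_le_div (Real.rpow_pos_of_pos hx0 _)]
        exact Real.rpow_le_rpow hx0.le (hψM x hx) (by linarith)
      have h2 : 0 ≤ Carleman.weight X α l p x * |u x| ^ 2 :=
        mul_nonneg (Real.exp_pos _).le (sq_nonneg _)
      calc _ ≤ (M ^ (2 * p + 2) * Carleman.psi X α x ^ (-2 * p - 2))
            * (Carleman.weight X α l p x * |u x| ^ 2) := le_mul_of_one_le_left h2 h1
        _ = _ := by ring
    have hL : (∫ x in Ω, Carleman.psi X α x ^ (p + 2) * Carleman.weight X α l p x
        * |Carleman.divAGrad A u x| ^ 2)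
        ≤ M ^ (p + 2) * ∫ x in Ω, Carleman.weight X α l p x * |Carleman.divAGrad A u x| ^ 2 := by
      rw [← integral_const_mul]
      refine setIntegral_mono_on j1 (j0.const_mul _) hΩ.measurableSet fun x hx => ?_
      have h2 : 0 ≤ Carleman.weight X α l p x * |Carleman.divAGrad A u x| ^ 2 :=
        mul_nonneg (Real.exp_pos _).le (sq_nonneg _)
      rw [mul_assoc]
      exact mul_le_mul_of_nonneg_right
        (Real.rpow_le_rpow (hpos x hx).le (hψM x hx) (by linarith)) h2
    set I₁ := ∫ x in Ω, Carleman.weight X α l p x * ‖gradient u x‖ ^ 2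
    set I₂ := ∫ x in Ω,
      Carleman.psi X α x ^ (-2 * p - 2) * Carleman.weight X α l p x * |u x| ^ 2
    have h1 : 0 ≤ I₁ :=
      integral_nonneg fun x => mul_nonneg (Real.exp_pos _).le (sq_nonneg _)
    have hM2 : 1 ≤ M ^ (2 * p + 2) := Real.one_le_rpow hM (by linarith)
    calc l * p * (I₁) + l ^ 3 * p ^ 4 * (∫ x in Ω, Carleman.weight X α l p x * |u x| ^ 2)
        ≤ M ^ (2 * p + 2) * (l * (p * p) * I₁) + l ^ 3 * p ^ 4 * (M ^ (2 * p + 2) * I₂) := by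
          have h4 : l * (p * 1) * I₁ ≤ l * (p * p) * I₁ := by gcongr
          have h5 : l * (p * p) * I₁ ≤ M ^ (2 * p + 2) * (l * (p * p) * I₁) :=
            le_mul_of_one_le_left (by positivity) hM2
          rw [mul_one] at h4
          exact add_le_add (h4.trans h5) (by gcongr)
      _ = M ^ (2 * p + 2) * (l * p ^ 2 * I₁ + l ^ 3 * p ^ 4 * I₂) := by ring
      _ ≤ M ^ (2 * p + 2) * (C * (M ^ (p + 2)
            * ∫ x in Ω, Carleman.weight X α l p x * |Carleman.divAGrad A u x| ^ 2)) := by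
          gcongr
          exact h.trans (by gcongr)
      _ = _ := by ring
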